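/- Work in the category of symmetric spectra in pointed simplicial sets. For such a spectrum $X$, with levels $X(m)$, $m\ge 0$, let $L_mX=(\bar S\wedge X)(m)$, where $\bar S$ is the symmetric spectrum with $\bar S(0)=*$ and $\bar S(m)=S^m$ for $m\ge 1$; the inclusion $\bar S\to S$ into the sphere spectrum induces $L_mX\to (S\wedge X)(m)\cong X(m)$. A morphism $f\colon X\to Y$ is a *flat cofibration* if for every $m\ge 0$ the map $X(m)\coprod_{L_mX}L_mY\to Y(m)$ is a monomorphism of pointed simplicial sets, and a *positive flat cofibration* if moreover $f(0)\colon X(0)\to Y(0)$ is an isomorphism. For a simplicial symmetric spectrum $X_\bullet$ let $\tilde L_0X_\bullet=*$, $\tilde L_1X_\bullet=X_0$ and, for $n\ge 2$, let $\tilde L_nX_\bullet$ be the coequalizer of the two maps $\coprod_{0\le i<j\le n-1}X_{n-2}\rightrightarrows\coprod_{0\le k\le n-1}X_{n-1}$ which on the summand $(i,j)$ are $s_i$ into the $j$-th summand and $s_{j-1}$ into the $i$-th summand, respectively. The degeneracies induce natural maps $\tilde L_nX_\bullet\to X_n$. A morphism $f_\bullet\colon X_\bullet\to Y_\bullet$ of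 simplicial symmetric spectra is a *Reedy (positive) flat cofibration* if for every $n\ge 0$ the map $X_n\coprod_{\tilde L_nX_\bullet}\tilde L_nY_\bullet\to Y_n$ is a (positive) flat cofibration, and a *pointwise (positive) flat cofibration* if every $f_n\colon X_n\to Y_n$ is a (positive) flat cofibration. The object $X_\bullet$ is *Reedy flat-cofibrant* if for every $n\ge 0$ the map $\tilde L_nX_\bullet\to X_n$ is a flat cofibration. The *geometric realization* of $X_\bullet$ is the coend $|X_\bullet|=\int^{[n]\in\Delta}X_n\wedge\Delta[n]_+$. **Theorem.** Let $f_\bullet\colon X_\bullet\to Y_\bullet$ be a morphism of simplicial symmetric spectra in pointed simplicial sets, and suppose that $X_\bullet$ and $Y_\bullet$ are both Reedy flat-cofibrant. 1. If $f_\bullet$ is a pointwise flat cofibration, then $f_\bullet$ is a Reedy flat cofibration, and $|f_\bullet|\colon|X_\bullet|\to|Y_\bullet|$ is a flat cofibration. 2. If $f_\bullet$ is a pointwise positive flat cofibration, then $f_\bullet$ is a Reedy positive flat cofibration, and $|f_\bullet|$ is a positive flat cofibration. -/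

import Mathlib

open CategoryTheory CategoryTheory.Limits Opposite

universe u

/-! ### Pointed sets and pointed simplicial sets -/

namespace Pointed

/-- The relation on `A × B` which collapses the wedge `A ∨ B` to a point. -/
inductive SmashRel (A B : Pointed.{u}) : A × B → A × B → Prop where
  | left (b : B) : SmashRel A B (A.point, b) (A.point, B.point)
  | right (a : A) : SmashRel A B (a, B.point) (A.point, B.point)

/-- The smash product `A ∧ B = (A × B) / (A ∨ B)` of pointed sets. -/
def smash (A B : Pointed.{u}) : Pointed.{u} :=
  Pointed.of (Quot.mk (SmashRel A B) (A.point, B.point))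

namespace smash

variable {A B C D : Pointed.{u}}

/-- The class `a ∧ b` in `A ∧ B`. -/
def mk (a : A) (b : B) : smash A B := Quot.mk _ (a, b)

@[simp] lemma mk_point_left (b : B) : mk A.point b = (smash A B).point :=
  Quot.sound (SmashRel.left b)

@[simp] lemma mk_point_right (a : A) : mk a B.point = (smash A B).point :=
  Quot.sound (SmashRel.right a)

/-- A map out of `A ∧ B` is a map in two variables which preserves the base points separately. -/
def lift (b : A → B → C) (h₁ : ∀ y, b A.point y = C.point) (h₂ : ∀ x, b x B.point = C.point) :
    smash A B ⟶ C where
  toFun := Quot.lift (fun p => b p.1 p.2) (by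
    rintro _ _ (y | x)
    · simp [h₁]
    · simp [h₁, h₂])
  map_point := h₁ _

@[simp] lemma lift_mk (b : A → B → C) (h₁ : ∀ y, b A.point y = C.point)
    (h₂ : ∀ x, b x B.point = C.point) (x : A) (y : B) :
    (lift b h₁ h₂).toFun (mk x y) = b x y := rfl

lemma hom_ext {f g : smash A B ⟶ C} (h : ∀ x y, f.toFun (mk x y) = g.toFun (mk x y)) :
    f = g := by
  apply Pointed.Hom.ext
  funext z
  induction z using Quot.inductionOn with
  | h z => exact h z.1 z.2

/-- The smash product of two pointed maps. -/
def map (f : A ⟶ C) (g : B ⟶ D) : smash A B ⟶ smash C D :=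
  lift (fun x y => mk (f.toFun x) (g.toFun y)) (fun y => by simp [f.map_point])
    (fun x => by simp [g.map_point])

@[simp] lemma map_mk (f : A ⟶ C) (g : B ⟶ D) (x : A) (y : B) :
    (map f g).toFun (mk x y) = mk (f.toFun x) (g.toFun y) := rfl

end smash

section Colimits

variable {J : Type} [SmallCategory J] (F : J ⥤ Pointed.{u})

/-- The relation defining the colimit of a diagram of pointed sets. -/
inductive ColimRel : Option (Σ j, F.obj j) → Option (Σ j, F.obj j) → Prop where
  | point (j : J) : ColimRel (some ⟨j, (F.obj j).point⟩) none
  | map {i j : J} (φ : i ⟶ j) (x : F.obj i) :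
      ColimRel (some ⟨i, x⟩) (some ⟨j, (F.map φ).toFun x⟩)

/-- An explicit colimit cocone of a diagram of pointed sets. -/
def colimCocone : Cocone F where
  pt := Pointed.of (Quot.mk (ColimRel F) none)
  ι :=
    { app := fun j => ⟨fun x => Quot.mk _ (some ⟨j, x⟩), Quot.sound (ColimRel.point j)⟩
      naturality := fun i j φ => by
        apply Pointed.Hom.ext
        funext x
        exact (Quot.sound (ColimRel.map φ x)).symm }

/-- The explicit cocone is a colimit. -/
def colimCoconeIsColimit : IsColimit (colimCocone F) where
  desc s := ⟨Quot.lift (fun o => o.elim s.pt.point (fun p => (s.ι.app p.1).toFun p.2)) (by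
      rintro _ _ (j | ⟨φ, x⟩)
      · exact (s.ι.app j).map_point
      · exact (congrFun (congrArg Pointed.Hom.toFun (s.w φ)) x).symm), rfl⟩
  fac s j := rfl
  uniq s m hm := by
    apply Pointed.Hom.ext
    funext z
    induction z using Quot.inductionOn with
    | h z =>
      rcases z with _ | ⟨j, x⟩
      · exact m.map_point
      · exact congrFun (congrArg Pointed.Hom.toFun (hm j)) x

/-- The class of `x : F j` in the colimit. -/
def colimIn (j : J) (x : F.obj j) : (colimCocone F).pt := Quot.mk _ (some ⟨j, x⟩)

lemma colimIn_point (j : J) : colimIn F j (F.obj j).point = (colimCocone F).pt.point :=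
  Quot.sound (ColimRel.point j)

lemma colimIn_map {i j : J} (φ : i ⟶ j) (x : F.obj i) :
    colimIn F j ((F.map φ).toFun x) = colimIn F i x :=
  (Quot.sound (ColimRel.map φ x)).symm

variable {F} in
lemma colim_induction {p : (colimCocone F).pt → Prop} (h : ∀ j x, p (colimIn F j x))
    (h₀ : p (colimCocone F).pt.point) (z : (colimCocone F).pt) : p z := by
  refine Quot.inductionOn (motive := p) z (fun o => ?_)
  rcases o with _ | ⟨j, x⟩
  · exact h₀
  · exact h j x

variable {F} in
/-- Functoriality of the explicit colimit. -/
def colimMap {G : J ⥤ Pointed.{u}} (α : F ⟶ G) : (colimCocone F).pt ⟶ (colimCocone G).pt :=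
  (colimCoconeIsColimit F).desc ((Cocone.precompose α).obj (colimCocone G))

instance : HasColimitsOfSize.{0, 0} Pointed.{u} where
  has_colimits_of_shape _ _ :=
    { has_colimit := fun F => ⟨⟨⟨colimCocone F, colimCoconeIsColimit F⟩⟩⟩ }

end Colimits

end Pointed

/-- The category of pointed simplicial sets. -/
abbrev PSSet : Type (u + 1) := SimplicialObject Pointed.{u}

namespace PSSet

lemma naturality_apply {A B : PSSet.{u}} (f : A ⟶ B) {k l : SimplexCategoryᵒᵖ} (φ : k ⟶ l)
    (x : A.obj k) :
    (f.app l).toFun ((A.map φ).toFun x) = (B.map φ).toFun ((f.app k).toFun x) :=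
  congrFun (congrArg Pointed.Hom.toFun (f.naturality φ)) x

/-- The functor `K ↦ K₊` adding a disjoint base point. -/
def plus : SSet.{u} ⥤ PSSet.{u} := (SimplicialObject.whiskering _ _).obj typeToPointed

/-- The smash product of pointed simplicial sets, formed in each simplicial degree. -/
def smash (A B : PSSet.{u}) : PSSet.{u} where
  obj k := Pointed.smash (A.obj k) (B.obj k)
  map φ := Pointed.smash.map (A.map φ) (B.map φ)
  map_id k := Pointed.smash.hom_ext fun x y => by simp
  map_comp φ ψ := Pointed.smash.hom_ext fun x y => by simp

/-- The smash product of two maps of pointed simplicial sets. -/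
def smashMap {A B C D : PSSet.{u}} (f : A ⟶ C) (g : B ⟶ D) : smash A B ⟶ smash C D where
  app k := Pointed.smash.map (f.app k) (g.app k)
  naturality k l φ := Pointed.smash.hom_ext fun x y => by
    simp [smash, naturality_apply]

@[simp] lemma smashMap_id (A B : PSSet.{u}) : smashMap (𝟙 A) (𝟙 B) = 𝟙 (smash A B) := by
  apply NatTrans.ext
  funext k
  exact Pointed.smash.hom_ext fun x y => rfl

lemma smashMap_id_comp {A B C D : PSSet.{u}} (f : A ⟶ B) (g : B ⟶ C) :
    smashMap (f ≫ g) (𝟙 D) = smashMap f (𝟙 D) ≫ smashMap g (𝟙 D) := by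
  apply NatTrans.ext
  funext k
  exact Pointed.smash.hom_ext fun x y => rfl

/-- The relation collapsing the simplices of `A ⊆ K` to the base point. -/
inductive QuotRel {K : SSet.{u}} (A : K.Subcomplex) (k : SimplexCategoryᵒᵖ) :
    Option (K.obj k) → Option (K.obj k) → Prop where
  | mk (x : K.obj k) (hx : x ∈ A.obj k) : QuotRel A k (some x) none

/-- The quotient `K / A` of a simplicial set by a subcomplex, as a pointed simplicial set. -/
def quotient {K : SSet.{u}} (A : K.Subcomplex) : PSSet.{u} where
  obj k := Pointed.of (Quot.mk (QuotRel A k) none)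
  map φ := ⟨Quot.map (Option.map (K.map φ)) (by
    rintro _ _ ⟨x, hx⟩
    exact QuotRel.mk _ (A.map φ hx)), rfl⟩
  map_id k := by
    apply Pointed.Hom.ext
    funext z
    induction z using Quot.inductionOn with
    | h z => cases z <;> simp [Quot.map]
  map_comp φ ψ := by
    apply Pointed.Hom.ext
    funext z
    induction z using Quot.inductionOn with
    | h z => cases z <;> simp [Quot.map]

/-- The simplicial circle `S¹ = Δ[1] / ∂Δ[1]`. -/
def S1 : PSSet.{u} := quotient (SSet.boundary.{u} 1)

end PSSet

/-! ### Symmetric spectra -/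

/-- The extension `e ⊔ {last}` of a bijection `Fin a ≃ Fin b` to a bijection
`Fin (a + 1) ≃ Fin (b + 1)`. -/
def succEquiv {a b : ℕ} (e : Fin a ≃ Fin b) : Fin (a + 1) ≃ Fin (b + 1) where
  toFun := Fin.lastCases (Fin.last b) (fun i => (e i).castSucc)
  invFun := Fin.lastCases (Fin.last a) (fun i => (e.symm i).castSucc)
  left_inv i := by refine Fin.lastCases ?_ (fun j => ?_) i <;> simp
  right_inv i := by refine Fin.lastCases ?_ (fun j => ?_) i <;> simp

@[simp] lemma succEquiv_last {a b : ℕ} (e : Fin a ≃ Fin b) :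
    succEquiv e (Fin.last a) = Fin.last b := by simp [succEquiv]

@[simp] lemma succEquiv_castSucc {a b : ℕ} (e : Fin a ≃ Fin b) (i : Fin a) :
    succEquiv e i.castSucc = (e i).castSucc := by simp [succEquiv]

/-- A symmetric spectrum in pointed simplicial sets: a sequence of pointed simplicial sets
`X(n)`, with a left action of `Σ_n` on `X(n)` and structure maps `σ : X(n) ∧ S¹ ⟶ X(n + 1)`,
such that the iterated structure maps `X(n) ∧ S^m ⟶ X(n + m)` are `Σ_n × Σ_m`-equivariant.
Since `Σ_m` is generated by the adjacent transpositions, the equivariance amounts to the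
`Σ_n`-equivariance of `σ` (the field `σ_act`) and to the `Σ_2`-equivariance of
`X(n) ∧ S¹ ∧ S¹ ⟶ X(n + 2)` (the field `σ_σ`); the general case is `SymSpectrum.iter_act` below. -/
structure SymSpectrum : Type (u + 1) where
  /-- The pointed simplicial set `X(n)`. -/
  level : ℕ → PSSet.{u}
  /-- The action of the symmetric group. Multiplication in `End` is `f * g = f ∘ g`, so this is
  a left action. -/
  act (n : ℕ) : Equiv.Perm (Fin n) →* End (level n)
  /-- The structure maps. -/
  σ (n : ℕ) : PSSet.smash (level n) PSSet.S1 ⟶ level (n + 1)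
  σ_act (n : ℕ) (τ : Equiv.Perm (Fin n)) :
    PSSet.smashMap (act n τ) (𝟙 PSSet.S1) ≫ σ n = σ n ≫ act (n + 1) (succEquiv τ)
  σ_σ (n : ℕ) (k : SimplexCategoryᵒᵖ) (x : (level n).obj k) (s t : PSSet.S1.obj k) :
    ((σ (n + 1)).app k).toFun (Pointed.smash.mk (((σ n).app k).toFun (Pointed.smash.mk x s)) t) =
      (Pointed.Hom.toFun
        (NatTrans.app (act (n + 2) (Equiv.swap (Fin.last n).castSucc (Fin.last (n + 1)))) k)
        (((σ (n + 1)).app k).toFun (Pointed.smash.mk (((σ n).app k).toFun (Pointed.smash.mk x t)) s)))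

namespace SymSpectrum

/-- A morphism of symmetric spectra: equivariant maps compatible with the structure maps. -/
@[ext]
structure Hom (X Y : SymSpectrum.{u}) : Type u where
  /-- The component `X(n) ⟶ Y(n)`. -/
  app (n : ℕ) : X.level n ⟶ Y.level n
  act_comm (n : ℕ) (τ : Equiv.Perm (Fin n)) : X.act n τ ≫ app n = app n ≫ Y.act n τ
  σ_comm (n : ℕ) : X.σ n ≫ app (n + 1) = PSSet.smashMap (app n) (𝟙 PSSet.S1) ≫ Y.σ n

instance : Category SymSpectrum.{u} where
  Hom := Hom
  id X :=
    { app := fun n => 𝟙 _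
      act_comm := fun n τ => by simp
      σ_comm := fun n => by simp }
  comp f g :=
    { app := fun n => f.app n ≫ g.app n
      act_comm := fun n τ => by
        rw [← Category.assoc, f.act_comm, Category.assoc, g.act_comm, Category.assoc]
      σ_comm := fun n => by
        rw [← Category.assoc, f.σ_comm, Category.assoc, g.σ_comm, PSSet.smashMap_id_comp,
          Category.assoc] }

@[simp] lemma id_app (X : SymSpectrum.{u}) (n : ℕ) : Hom.app (𝟙 X) n = 𝟙 _ := rfl

@[simp] lemma comp_app {X Y Z : SymSpectrum.{u}} (f : X ⟶ Y) (g : Y ⟶ Z) (n : ℕ) :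
    Hom.app (f ≫ g) n = f.app n ≫ g.app n := rfl

@[ext] lemma hom_ext {X Y : SymSpectrum.{u}} {f g : X ⟶ Y} (h : ∀ n, f.app n = g.app n) : f = g :=
  Hom.ext (funext h)

/-- The functor `X ↦ X(n)`. -/
@[simps]
def ev (n : ℕ) : SymSpectrum.{u} ⥤ PSSet.{u} where
  obj X := X.level n
  map f := f.app n

section Elements

variable (X : SymSpectrum.{u}) {k l : SimplexCategoryᵒᵖ}

/-- The action of a permutation on elements. -/
def perm {n : ℕ} (τ : Equiv.Perm (Fin n)) (x : (X.level n).obj k) : (X.level n).obj k :=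
  Pointed.Hom.toFun (NatTrans.app (X.act n τ) k) x

/-- The structure map on elements. -/
def sig {n : ℕ} (x : (X.level n).obj k) (t : PSSet.S1.{u}.obj k) : (X.level (n + 1)).obj k :=
  ((X.σ n).app k).toFun (Pointed.smash.mk x t)

lemma perm_one {n : ℕ} (x : (X.level n).obj k) : X.perm 1 x = x := by
  simp only [perm, map_one]; rfl

lemma perm_mul {n : ℕ} (τ π : Equiv.Perm (Fin n)) (x : (X.level n).obj k) :
    X.perm (τ * π) x = X.perm τ (X.perm π x) := by
  simp only [perm, map_mul]; rfl

lemma perm_point {n : ℕ} (τ : Equiv.Perm (Fin n)) :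
    X.perm τ ((X.level n).obj k).point = ((X.level n).obj k).point :=
  Pointed.Hom.map_point _

lemma perm_map {n : ℕ} (τ : Equiv.Perm (Fin n)) (φ : k ⟶ l) (x : (X.level n).obj k) :
    X.perm τ (((X.level n).map φ).toFun x) = ((X.level n).map φ).toFun (X.perm τ x) :=
  PSSet.naturality_apply _ _ _

@[simp] lemma sig_point_left {n : ℕ} (t : PSSet.S1.{u}.obj k) :
    X.sig ((X.level n).obj k).point t = ((X.level (n + 1)).obj k).point := by
  simp only [sig, Pointed.smash.mk_point_left]
  exact Pointed.Hom.map_point _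

@[simp] lemma sig_point_right {n : ℕ} (x : (X.level n).obj k) :
    X.sig x (PSSet.S1.{u}.obj k).point = ((X.level (n + 1)).obj k).point := by
  simp only [sig, Pointed.smash.mk_point_right]
  exact Pointed.Hom.map_point _

lemma sig_map {n : ℕ} (φ : k ⟶ l) (x : (X.level n).obj k) (t : PSSet.S1.{u}.obj k) :
    X.sig (((X.level n).map φ).toFun x) ((PSSet.S1.{u}.map φ).toFun t) =
      ((X.level (n + 1)).map φ).toFun (X.sig x t) :=
  PSSet.naturality_apply (X.σ n) φ (Pointed.smash.mk x t)

lemma sig_perm {n : ℕ} (τ : Equiv.Perm (Fin n)) (x : (X.level n).obj k) (t : PSSet.S1.{u}.obj k) :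
    X.sig (X.perm τ x) t = X.perm (succEquiv τ) (X.sig x t) :=
  congrFun (congrArg Pointed.Hom.toFun (NatTrans.congr_app (X.σ_act n τ) k)) (Pointed.smash.mk x t)

lemma sig_sig {n : ℕ} (x : (X.level n).obj k) (s t : PSSet.S1.{u}.obj k) :
    X.sig (X.sig x s) t =
      X.perm (Equiv.swap (Fin.last n).castSucc (Fin.last (n + 1))) (X.sig (X.sig x t) s) :=
  X.σ_σ n k x s t

variable {X} in
lemma Hom.app_perm {Y : SymSpectrum.{u}} (f : X ⟶ Y) {n : ℕ} (τ : Equiv.Perm (Fin n))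
    (x : (X.level n).obj k) :
    ((f.app n).app k).toFun (X.perm τ x) = Y.perm τ (((f.app n).app k).toFun x) :=
  congrFun (congrArg Pointed.Hom.toFun (NatTrans.congr_app (f.act_comm n τ) k)) x

variable {X} in
lemma Hom.app_sig {Y : SymSpectrum.{u}} (f : X ⟶ Y) {n : ℕ}
    (x : (X.level n).obj k) (t : PSSet.S1.{u}.obj k) :
    ((f.app (n + 1)).app k).toFun (X.sig x t) = Y.sig (((f.app n).app k).toFun x) t :=
  congrFun (congrArg Pointed.Hom.toFun (NatTrans.congr_app (f.σ_comm n) k)) (Pointed.smash.mk x t)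

/-- Constructor of symmetric spectra from structure maps given on elements. -/
def ofElements (level : ℕ → PSSet.{u}) (act : (n : ℕ) → Equiv.Perm (Fin n) →* End (level n))
    (b : ∀ {n : ℕ} {k : SimplexCategoryᵒᵖ}, (level n).obj k → PSSet.S1.{u}.obj k →
      (level (n + 1)).obj k)
    (b_left : ∀ {n : ℕ} {k : SimplexCategoryᵒᵖ} (t : PSSet.S1.{u}.obj k),
      b ((level n).obj k).point t = ((level (n + 1)).obj k).point)
    (b_right : ∀ {n : ℕ} {k : SimplexCategoryᵒᵖ} (x : (level n).obj k),
      b x (PSSet.S1.{u}.obj k).point = ((level (n + 1)).obj k).point)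
    (b_map : ∀ {n : ℕ} {k l : SimplexCategoryᵒᵖ} (φ : k ⟶ l) (x : (level n).obj k)
      (t : PSSet.S1.{u}.obj k), b (((level n).map φ).toFun x) ((PSSet.S1.{u}.map φ).toFun t) =
        ((level (n + 1)).map φ).toFun (b x t))
    (b_act : ∀ {n : ℕ} {k : SimplexCategoryᵒᵖ} (τ : Equiv.Perm (Fin n)) (x : (level n).obj k)
      (t : PSSet.S1.{u}.obj k), b (Pointed.Hom.toFun (NatTrans.app (act n τ) k) x) t =
        Pointed.Hom.toFun (NatTrans.app (act (n + 1) (succEquiv τ)) k) (b x t))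
    (b_b : ∀ {n : ℕ} {k : SimplexCategoryᵒᵖ} (x : (level n).obj k) (s t : PSSet.S1.{u}.obj k),
      b (b x s) t = Pointed.Hom.toFun
        (NatTrans.app (act (n + 2) (Equiv.swap (Fin.last n).castSucc (Fin.last (n + 1)))) k)
        (b (b x t) s)) : SymSpectrum.{u} where
  level := level
  act := act
  σ n :=
    { app := fun k => Pointed.smash.lift b b_left b_right
      naturality := fun k l φ => Pointed.smash.hom_ext fun x t => b_map φ x t }
  σ_act n τ := by
    apply NatTrans.ext
    funext k
    exact Pointed.smash.hom_ext fun x t => b_act τ x t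
  σ_σ n k x s t := b_b x s t

/-- Constructor of morphisms of symmetric spectra from compatibilities on elements. -/
def homMk {X Y : SymSpectrum.{u}} (app : (n : ℕ) → (X.level n ⟶ Y.level n))
    (h_act : ∀ {n : ℕ} {k : SimplexCategoryᵒᵖ} (τ : Equiv.Perm (Fin n)) (x : (X.level n).obj k),
      ((app n).app k).toFun (X.perm τ x) = Y.perm τ (((app n).app k).toFun x))
    (h_sig : ∀ {n : ℕ} {k : SimplexCategoryᵒᵖ} (x : (X.level n).obj k) (t : PSSet.S1.{u}.obj k),
      ((app (n + 1)).app k).toFun (X.sig x t) = Y.sig (((app n).app k).toFun x) t) :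
    X ⟶ Y where
  app := app
  act_comm n τ := by
    apply NatTrans.ext
    funext k
    apply Pointed.Hom.ext
    funext x
    exact h_act τ x
  σ_comm n := by
    apply NatTrans.ext
    funext k
    exact Pointed.smash.hom_ext fun x t => h_sig x t

end Elements

/-! #### Iterated structure maps -/

section Iterated

variable (X : SymSpectrum.{u}) {k l : SimplexCategoryᵒᵖ}

/-- The iterated structure map `X(n) ∧ S¹ ∧ ⋯ ∧ S¹ ⟶ X(n + m)` on elements. -/
def iter {n : ℕ} (x : (X.level n).obj k) : (m : ℕ) → (Fin m → PSSet.S1.{u}.obj k) →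
    (X.level (n + m)).obj k
  | 0, _ => x
  | m + 1, s => X.sig (iter x m (fun i => s i.castSucc)) (s (Fin.last m))

lemma iter_point {n : ℕ} (m : ℕ) (s : Fin m → PSSet.S1.{u}.obj k) :
    X.iter ((X.level n).obj k).point m s = ((X.level (n + m)).obj k).point := by
  induction m with
  | zero => rfl
  | succ m ih => simp only [iter, ih]; exact X.sig_point_left _

lemma iter_point_right {n : ℕ} (x : (X.level n).obj k) (m : ℕ) (s : Fin m → PSSet.S1.{u}.obj k)
    (i : Fin m) (hi : s i = (PSSet.S1.{u}.obj k).point) :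
    X.iter x m s = ((X.level (n + m)).obj k).point := by
  induction m with
  | zero => exact i.elim0
  | succ m ih =>
    simp only [iter]
    induction i using Fin.lastCases with
    | last => rw [hi]; exact X.sig_point_right _
    | cast j => rw [ih (fun i => s i.castSucc) j hi]; exact X.sig_point_left _

lemma iter_map {n : ℕ} (φ : k ⟶ l) (x : (X.level n).obj k) (m : ℕ)
    (s : Fin m → PSSet.S1.{u}.obj k) :
    X.iter (((X.level n).map φ).toFun x) m (fun i => (PSSet.S1.{u}.map φ).toFun (s i)) =
      ((X.level (n + m)).map φ).toFun (X.iter x m s) := by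
  induction m with
  | zero => rfl
  | succ m ih =>
    simp only [iter, ih (fun i => s i.castSucc)]
    exact X.sig_map φ _ _

/-- The block sum `τ ⊕ π` of two permutations. -/
def blockSum {n m : ℕ} (τ : Equiv.Perm (Fin n)) (π : Equiv.Perm (Fin m)) :
    Equiv.Perm (Fin (n + m)) :=
  finSumFinEquiv.permCongr (Equiv.sumCongr τ π)

@[simp] lemma blockSum_castAdd {n m : ℕ} (τ : Equiv.Perm (Fin n)) (π : Equiv.Perm (Fin m))
    (i : Fin n) : blockSum τ π (Fin.castAdd m i) = Fin.castAdd m (τ i) := by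
  simp [blockSum, Equiv.permCongr_apply]

@[simp] lemma blockSum_natAdd {n m : ℕ} (τ : Equiv.Perm (Fin n)) (π : Equiv.Perm (Fin m))
    (i : Fin m) : blockSum τ π (Fin.natAdd n i) = Fin.natAdd n (π i) := by
  simp [blockSum, Equiv.permCongr_apply]

lemma blockSum_mul {n m : ℕ} (τ τ' : Equiv.Perm (Fin n)) (π π' : Equiv.Perm (Fin m)) :
    blockSum (τ * τ') (π * π') = blockSum τ π * blockSum τ' π' := by
  ext i
  induction i using Fin.addCases <;> simp

lemma blockSum_one {n m : ℕ} : blockSum (1 : Equiv.Perm (Fin n)) (1 : Equiv.Perm (Fin m)) = 1 := by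
  ext i
  induction i using Fin.addCases <;> simp

lemma blockSum_succ {n m : ℕ} (τ : Equiv.Perm (Fin n)) (π : Equiv.Perm (Fin m)) :
    blockSum τ (succEquiv π) = (succEquiv (blockSum τ π) : Equiv.Perm (Fin (n + m + 1))) := by
  ext i
  induction i using Fin.addCases (m := n) (n := m + 1) with
  | left i =>
    have : (Fin.castAdd (m + 1) i : Fin (n + (m + 1))) = (Fin.castAdd m i).castSucc := rfl
    rw [blockSum_castAdd, this, succEquiv_castSucc, blockSum_castAdd]
    rfl
  | right i =>
    rw [blockSum_natAdd]
    induction i using Fin.lastCases with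
    | last =>
      have : (Fin.natAdd n (Fin.last m) : Fin (n + (m + 1))) = Fin.last (n + m) := rfl
      rw [this, succEquiv_last, succEquiv_last]
      rfl
    | cast i =>
      have : (Fin.natAdd n i.castSucc : Fin (n + (m + 1))) = (Fin.natAdd n i).castSucc := rfl
      rw [this, succEquiv_castSucc, succEquiv_castSucc, blockSum_natAdd]
      rfl

lemma succEquiv_one {n : ℕ} : (succEquiv (1 : Equiv.Perm (Fin n)) : Equiv.Perm _) = 1 := by
  ext i
  induction i using Fin.lastCases <;> simp

lemma succEquiv_swap {n : ℕ} (i j : Fin n) :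
    (succEquiv (Equiv.swap i j) : Equiv.Perm _) = Equiv.swap i.castSucc j.castSucc := by
  ext a
  induction a using Fin.lastCases with
  | last =>
    rw [succEquiv_last, Equiv.swap_apply_of_ne_of_ne (Fin.castSucc_lt_last i).ne'
      (Fin.castSucc_lt_last j).ne']
  | cast a =>
    rw [succEquiv_castSucc, (Fin.castSucc_injective n).swap_apply]

lemma iter_perm_left {n : ℕ} (τ : Equiv.Perm (Fin n)) (x : (X.level n).obj k) (m : ℕ)
    (s : Fin m → PSSet.S1.{u}.obj k) :
    X.iter (X.perm τ x) m s = X.perm (blockSum τ 1) (X.iter x m s) := by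
  induction m with
  | zero =>
    have : blockSum τ (1 : Equiv.Perm (Fin 0)) = τ := by
      ext i
      exact congrArg Fin.val (blockSum_castAdd τ (1 : Equiv.Perm (Fin 0)) i)
    simp only [iter]
    exact (congrArg (fun π => X.perm π x) this).symm
  | succ m ih =>
    simp only [iter, ih]
    rw [sig_perm, ← blockSum_succ, succEquiv_one]

lemma iter_swap {n : ℕ} (x : (X.level n).obj k) (m : ℕ) (i : Fin m)
    (s : Fin (m + 1) → PSSet.S1.{u}.obj k) :
    X.iter x (m + 1) (fun j => s (Equiv.swap i.castSucc i.succ j)) =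
      X.perm (blockSum 1 (Equiv.swap i.castSucc i.succ)) (X.iter x (m + 1) s) := by
  induction m with
  | zero => exact i.elim0
  | succ m ih =>
    induction i using Fin.lastCases with
    | last =>
      have hs : (Equiv.swap (Fin.natAdd n (Fin.last m).castSucc)
          (Fin.natAdd n (Fin.last m).succ) : Equiv.Perm (Fin (n + (m + 2)))) =
          Equiv.swap (Fin.last (n + m)).castSucc (Fin.last (n + m + 1)) := rfl
      have hb : blockSum (1 : Equiv.Perm (Fin n)) (Equiv.swap (Fin.last m).castSucc
          (Fin.last m).succ) = (Equiv.swap (Fin.last (n + m)).castSucc (Fin.last (n + m + 1)) :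
            Equiv.Perm (Fin (n + (m + 2)))) := by
        rw [← hs]
        ext j
        induction j using Fin.addCases (m := n) (n := m + 2) with
        | left j =>
          rw [blockSum_castAdd, Equiv.swap_apply_of_ne_of_ne]
          · rfl
          · intro h; have := congrArg Fin.val h; simp at this; omega
          · intro h; have := congrArg Fin.val h; simp at this; omega
        | right j =>
          rw [blockSum_natAdd, (Fin.natAdd_injective (m + 2) n).swap_apply]
      rw [hb]
      simp only [iter]
      rw [Fin.succ_last, Equiv.swap_apply_right, Equiv.swap_apply_left]
      have h1 : ∀ j : Fin m, Equiv.swap (Fin.last m).castSucc (Fin.last (m + 1))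
          j.castSucc.castSucc = j.castSucc.castSucc := fun j =>
        Equiv.swap_apply_of_ne_of_ne
          (fun h => (Fin.castSucc_lt_last j).ne (Fin.castSucc_injective _ h))
          (Fin.castSucc_lt_last _).ne
      simp only [h1]
      exact X.sig_sig _ _ _
    | cast i =>
      have h1 : Equiv.swap i.castSucc.castSucc i.castSucc.succ =
          (succEquiv (Equiv.swap i.castSucc i.succ) : Equiv.Perm (Fin (m + 2))) := by
        rw [succEquiv_swap]; rfl
      rw [h1, blockSum_succ]
      have h2 := ih i (fun j => s j.castSucc)
      have h3 : (fun j : Fin (m + 1) => s (succEquiv (Equiv.swap i.castSucc i.succ) j.castSucc)) =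
          fun j => s (Equiv.swap i.castSucc i.succ j).castSucc := by
        funext j; rw [succEquiv_castSucc]
      change X.sig (X.iter x (m + 1) (fun j : Fin (m + 1) =>
        s (succEquiv (Equiv.swap i.castSucc i.succ) j.castSucc)))
        (s (succEquiv (Equiv.swap i.castSucc i.succ) (Fin.last (m + 1)))) = _
      rw [h3, h2, succEquiv_last]
      exact X.sig_perm _ _ _

/-- The iterated structure maps are `Σ_n × Σ_m`-equivariant. -/
theorem iter_act {n m : ℕ} (τ : Equiv.Perm (Fin n)) (π : Equiv.Perm (Fin m))
    (x : (X.level n).obj k) (s : Fin m → PSSet.S1.{u}.obj k) :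
    X.iter (X.perm τ x) m (fun i => s (π.symm i)) = X.perm (blockSum τ π) (X.iter x m s) := by
  have key : ∀ (s : Fin m → PSSet.S1.{u}.obj k),
      X.iter x m (fun i => s (π.symm i)) = X.perm (blockSum 1 π) (X.iter x m s) := by
    cases m with
    | zero =>
      intro s
      rw [Subsingleton.elim π 1, blockSum_one, perm_one]
      rfl
    | succ m =>
      have hπ : π ∈ Submonoid.closure
          (Set.range fun i : Fin m => Equiv.swap i.castSucc i.succ) := by
        rw [Equiv.Perm.mclosure_swap_castSucc_succ]; trivial
      induction hπ using Submonoid.closure_induction with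
      | mem π hπ =>
        obtain ⟨i, rfl⟩ := hπ
        intro s
        exact X.iter_swap x m i s
      | one => intro s; rw [blockSum_one, perm_one]; rfl
      | mul π ρ _ _ hπ hρ =>
        intro s
        have h := hπ (fun i => s (ρ.symm i))
        rw [hρ s, ← perm_mul, ← blockSum_mul, one_mul] at h
        exact h
  rw [iter_perm_left, key, ← perm_mul, ← blockSum_mul, mul_one, one_mul]

/-- The action of the bijections `Fin a ≃ Fin b`, where necessarily `a = b`. -/
def mapE {a b : ℕ} (e : Fin a ≃ Fin b) : (X.level a).obj k → (X.level b).obj k :=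
  match Fin.equiv_iff_eq.mp ⟨e⟩, e with
  | rfl, e => X.perm e

@[simp] lemma mapE_perm {a : ℕ} (e : Equiv.Perm (Fin a)) (x : (X.level a).obj k) :
    X.mapE e x = X.perm e x := rfl

lemma mapE_trans {a b c : ℕ} (e : Fin a ≃ Fin b) (e' : Fin b ≃ Fin c) (x : (X.level a).obj k) :
    X.mapE (e.trans e') x = X.mapE e' (X.mapE e x) := by
  obtain rfl : a = b := Fin.equiv_iff_eq.mp ⟨e⟩
  obtain rfl : a = c := Fin.equiv_iff_eq.mp ⟨e'⟩
  exact X.perm_mul e' e x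

lemma mapE_point {a b : ℕ} (e : Fin a ≃ Fin b) :
    X.mapE e ((X.level a).obj k).point = ((X.level b).obj k).point := by
  obtain rfl : a = b := Fin.equiv_iff_eq.mp ⟨e⟩
  exact X.perm_point e

lemma mapE_map {a b : ℕ} (e : Fin a ≃ Fin b) (φ : k ⟶ l) (x : (X.level a).obj k) :
    X.mapE e (((X.level a).map φ).toFun x) = ((X.level b).map φ).toFun (X.mapE e x) := by
  obtain rfl : a = b := Fin.equiv_iff_eq.mp ⟨e⟩
  exact X.perm_map e φ x

lemma sig_mapE {a b : ℕ} (e : Fin a ≃ Fin b) (x : (X.level a).obj k) (t : PSSet.S1.{u}.obj k) :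
    X.sig (X.mapE e x) t = X.mapE (succEquiv e) (X.sig x t) := by
  obtain rfl : a = b := Fin.equiv_iff_eq.mp ⟨e⟩
  exact X.sig_perm e x t

variable {X} in
lemma Hom.app_mapE {Y : SymSpectrum.{u}} (f : X ⟶ Y) {a b : ℕ} (e : Fin a ≃ Fin b)
    (x : (X.level a).obj k) :
    ((f.app b).app k).toFun (X.mapE e x) = Y.mapE e (((f.app a).app k).toFun x) := by
  obtain rfl : a = b := Fin.equiv_iff_eq.mp ⟨e⟩
  exact Hom.app_perm f e x

variable {X} in
lemma Hom.app_iter {Y : SymSpectrum.{u}} (f : X ⟶ Y) {n : ℕ} (x : (X.level n).obj k) (m : ℕ)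
    (s : Fin m → PSSet.S1.{u}.obj k) :
    ((f.app (n + m)).app k).toFun (X.iter x m s) = Y.iter (((f.app n).app k).toFun x) m s := by
  induction m with
  | zero => rfl
  | succ m ih =>
    simp only [iter, ← ih]
    exact Hom.app_sig f _ _

end Iterated

/-! #### Colimits of symmetric spectra -/

section Colimits

variable {J : Type} [SmallCategory J] (F : J ⥤ SymSpectrum.{u})

/-- The diagram of pointed sets `j ↦ F(j)(n)_k`. -/
abbrev diag (n : ℕ) (k : SimplexCategoryᵒᵖ) : J ⥤ Pointed.{u} :=
  F ⋙ ev n ⋙ (evaluation _ _).obj k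

/-- The levels of the colimit, formed in each level and simplicial degree. -/
def colimLevel (n : ℕ) : PSSet.{u} where
  obj k := (Pointed.colimCocone (diag F n k)).pt
  map φ := Pointed.colimMap (Functor.whiskerLeft F (Functor.whiskerLeft (ev n)
    ((evaluation _ _).map φ)))
  map_id k := by
    apply Pointed.Hom.ext
    funext z
    induction z using Pointed.colim_induction with
    | h j x =>
      exact congrArg (Pointed.colimIn (diag F n k) j) (by simp)
    | h₀ => rfl
  map_comp φ ψ := by
    apply Pointed.Hom.ext
    funext z
    induction z using Pointed.colim_induction with
    | h j x =>
      exact congrArg (Pointed.colimIn (diag F n _) j) (by simp)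
    | h₀ => rfl

/-- The class of `x : F(j)(n)_k` in the colimit. -/
def colimIn (n : ℕ) (k : SimplexCategoryᵒᵖ) (j : J) (x : ((F.obj j).level n).obj k) :
    (colimLevel F n).obj k := Pointed.colimIn (diag F n k) j x

lemma colimIn_map {n : ℕ} {k : SimplexCategoryᵒᵖ} {i j : J} (φ : i ⟶ j)
    (x : ((F.obj i).level n).obj k) :
    colimIn F n k j ((((F.map φ).app n).app k).toFun x) = colimIn F n k i x :=
  Pointed.colimIn_map (diag F n k) φ x

lemma colimIn_point (n : ℕ) (k : SimplexCategoryᵒᵖ) (j : J) :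
    colimIn F n k j (((F.obj j).level n).obj k).point = ((colimLevel F n).obj k).point :=
  Pointed.colimIn_point (diag F n k) j

variable {F} in
lemma colim_induction {n : ℕ} {k : SimplexCategoryᵒᵖ} {p : (colimLevel F n).obj k → Prop}
    (h : ∀ j x, p (colimIn F n k j x)) (h₀ : p ((colimLevel F n).obj k).point)
    (z : (colimLevel F n).obj k) : p z :=
  Pointed.colim_induction (F := diag F n k) h h₀ z

/-- The action of a permutation on the levels of the colimit. -/
def colimAct (n : ℕ) (τ : Equiv.Perm (Fin n)) : End (colimLevel F n) where
  app k := Pointed.colimMap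
    { app := fun j => NatTrans.app ((F.obj j).act n τ) k
      naturality := fun i j φ =>
        (NatTrans.congr_app ((F.map φ).act_comm n τ) k).symm }
  naturality k l φ := by
    apply Pointed.Hom.ext
    funext z
    induction z using Pointed.colim_induction with
    | h j x => exact congrArg (colimIn F n l j) ((F.obj j).perm_map τ φ x)
    | h₀ => rfl

/-- The structure map of the colimit on elements. -/
def colimSig {n : ℕ} {k : SimplexCategoryᵒᵖ} (z : (colimLevel F n).obj k)
    (t : PSSet.S1.{u}.obj k) : (colimLevel F (n + 1)).obj k :=
  (Pointed.colimMap (F := diag F n k) (G := diag F (n + 1) k)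
    { app := fun j => ⟨fun x => (F.obj j).sig x t, (F.obj j).sig_point_left t⟩
      naturality := fun i j φ => by
        apply Pointed.Hom.ext
        funext x
        exact (Hom.app_sig (F.map φ) x t).symm }).toFun z

/-- The colimit of a diagram of symmetric spectra, formed levelwise. -/
def colimSpectrum : SymSpectrum.{u} :=
  ofElements (colimLevel F)
    (fun n =>
      { toFun := colimAct F n
        map_one' := by
          apply NatTrans.ext
          funext k
          apply Pointed.Hom.ext
          funext z
          induction z using Pointed.colim_induction with
          | h j x => exact congrArg (colimIn F n k j) ((F.obj j).perm_one x)
          | h₀ => rfl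
        map_mul' := fun τ π => by
          apply NatTrans.ext
          funext k
          apply Pointed.Hom.ext
          funext z
          induction z using Pointed.colim_induction with
          | h j x => exact congrArg (colimIn F n k j) ((F.obj j).perm_mul τ π x)
          | h₀ => rfl })
    (fun z t => colimSig F z t)
    (fun t => rfl)
    (fun {n k} z => by
      induction z using colim_induction with
      | h j x =>
        exact (congrArg (colimIn F (n + 1) k j) ((F.obj j).sig_point_right x)).trans
          (colimIn_point F _ _ j)
      | h₀ => rfl)
    (fun {n k l} φ z t => by
      induction z using colim_induction with
      | h j x => exact congrArg (colimIn F (n + 1) l j) ((F.obj j).sig_map φ x t)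
      | h₀ => rfl)
    (fun {n k} τ z t => by
      induction z using colim_induction with
      | h j x => exact congrArg (colimIn F (n + 1) k j) ((F.obj j).sig_perm τ x t)
      | h₀ => rfl)
    (fun {n k} z s t => by
      induction z using colim_induction with
      | h j x => exact congrArg (colimIn F (n + 2) k j) ((F.obj j).sig_sig x s t)
      | h₀ => rfl)

/-- The colimit cocone. -/
def colimCocone : Cocone F where
  pt := colimSpectrum F
  ι :=
    { app := fun j => homMk
        (fun n =>
          { app := fun k => ⟨colimIn F n k j, colimIn_point F n k j⟩
            naturality := fun k l φ => rfl })
        (fun τ x => rfl) (fun x t => rfl)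
      naturality := fun i j φ => by
        apply hom_ext
        intro n
        apply NatTrans.ext
        funext k
        apply Pointed.Hom.ext
        funext x
        exact colimIn_map F φ x }

/-- The cocone of pointed sets obtained from a cocone of symmetric spectra. -/
abbrev diagCocone (s : Cocone F) (n : ℕ) (k : SimplexCategoryᵒᵖ) : Cocone (diag F n k) :=
  (ev n ⋙ (evaluation _ _).obj k).mapCocone s

/-- The levelwise cocone is a colimit. -/
def colimCoconeIsColimit : IsColimit (colimCocone F) where
  desc s := homMk
    (fun n =>
      { app := fun k => (Pointed.colimCoconeIsColimit (diag F n k)).desc (diagCocone F s n k)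
        naturality := fun k l φ => by
          apply Pointed.Hom.ext
          funext z
          induction z using Pointed.colim_induction with
          | h j x => exact PSSet.naturality_apply (Hom.app (s.ι.app j) n) φ x
          | h₀ => exact (Pointed.Hom.map_point ((s.pt.level n).map φ)).symm })
    (fun {n k} τ z => by
      induction z using colim_induction with
      | h j x => exact Hom.app_perm (s.ι.app j) τ x
      | h₀ => exact (s.pt.perm_point τ).symm)
    (fun {n k} z t => by
      induction z using colim_induction with
      | h j x => exact Hom.app_sig (s.ι.app j) x t
      | h₀ => exact (s.pt.sig_point_left t).symm)
  fac s j := rfl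
  uniq s m hm := by
    apply hom_ext
    intro n
    apply NatTrans.ext
    funext k
    refine (Pointed.colimCoconeIsColimit (diag F n k)).uniq (diagCocone F s n k)
      ((Hom.app m n).app k) (fun j => ?_)
    exact congrArg (fun g : F.obj j ⟶ s.pt => (Hom.app g n).app k) (hm j)

instance : HasColimitsOfSize.{0, 0} SymSpectrum.{u} where
  has_colimits_of_shape _ _ :=
    { has_colimit := fun F => ⟨⟨⟨colimCocone F, colimCoconeIsColimit F⟩⟩⟩ }

end Colimits

/-! #### The trivial spectrum -/

/-- The trivial symmetric spectrum `*`. -/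
def pointSpectrum : SymSpectrum.{u} :=
  ofElements (fun _ => (Functor.const _).obj (Pointed.of PUnit.unit)) (fun _ => 1)
    (fun _ _ => PUnit.unit) (fun _ => rfl) (fun _ => rfl) (fun _ _ _ => rfl) (fun _ _ _ => rfl)
    (fun _ _ _ => rfl)

lemma isZero_pointSpectrum : IsZero pointSpectrum.{u} where
  unique_to X := ⟨{
    default := homMk
      (fun n =>
        { app := fun k => ⟨fun _ => ((X.level n).obj k).point, rfl⟩
          naturality := fun k l φ => by
            apply Pointed.Hom.ext
            funext x
            exact (Pointed.Hom.map_point ((X.level n).map φ)).symm })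
      (fun τ x => (X.perm_point τ).symm) (fun x t => (X.sig_point_left t).symm)
    uniq := fun f => by
      apply hom_ext
      intro n
      apply NatTrans.ext
      funext k
      apply Pointed.Hom.ext
      funext x
      exact Pointed.Hom.map_point ((f.app n).app k) }⟩
  unique_from X := ⟨{
    default := homMk
      (fun n =>
        { app := fun k => ⟨fun _ => PUnit.unit, rfl⟩
          naturality := fun k l φ => rfl })
      (fun τ x => rfl) (fun x t => rfl)
    uniq := fun f => by
      apply hom_ext
      intro n
      apply NatTrans.ext
      funext k
      apply Pointed.Hom.ext
      funext x
      rfl }⟩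

instance : HasZeroObject SymSpectrum.{u} := ⟨⟨pointSpectrum, isZero_pointSpectrum⟩⟩

/-! #### The sphere spectrum `S` and the spectrum `S̄` -/

/-- The relation collapsing the fat wedge in `(S¹)^n` to the base point. -/
inductive SphereRel (m n : ℕ) (k : SimplexCategoryᵒᵖ) :
    Option {_s : Fin n → PSSet.S1.{u}.obj k // m ≤ n} →
    Option {_s : Fin n → PSSet.S1.{u}.obj k // m ≤ n} → Prop
  | mk (h : m ≤ n) (s : Fin n → PSSet.S1.{u}.obj k) (i : Fin n)
      (hi : s i = (PSSet.S1.{u}.obj k).point) : SphereRel m n k (some ⟨s, h⟩) none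

/-- The pointed simplicial set `S^n = S¹ ∧ ⋯ ∧ S¹` (with `S^0 = {*, pt}`) if `m ≤ n`, and `*`
otherwise. -/
def sphereLevel (m n : ℕ) : PSSet.{u} where
  obj k := Pointed.of (Quot.mk (SphereRel m n k) none)
  map {k l} φ := ⟨Quot.map (Option.map fun s => ⟨fun i => (PSSet.S1.map φ).toFun (s.1 i), s.2⟩) (by
    rintro _ _ ⟨h, s, i, hi⟩
    exact SphereRel.mk h _ i ((congrArg _ hi).trans (Pointed.Hom.map_point _))), rfl⟩
  map_id k := by
    apply Pointed.Hom.ext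
    funext z
    induction z using Quot.inductionOn with
    | h z => cases z <;> simp [Quot.map]
  map_comp φ ψ := by
    apply Pointed.Hom.ext
    funext z
    induction z using Quot.inductionOn with
    | h z => cases z <;> simp [Quot.map]

/-- The class `s 0 ∧ ⋯ ∧ s (n - 1)` in `S^n`. -/
def sphereMk {m n : ℕ} {k : SimplexCategoryᵒᵖ} (h : m ≤ n) (s : Fin n → PSSet.S1.{u}.obj k) :
    (sphereLevel m n).obj k := Quot.mk _ (some ⟨s, h⟩)

lemma sphereMk_eq_point {m n : ℕ} {k : SimplexCategoryᵒᵖ} (h : m ≤ n)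
    (s : Fin n → PSSet.S1.{u}.obj k) (i : Fin n) (hi : s i = (PSSet.S1.{u}.obj k).point) :
    sphereMk h s = ((sphereLevel m n).obj k).point :=
  Quot.sound (SphereRel.mk h s i hi)

lemma sphere_induction {m n : ℕ} {k : SimplexCategoryᵒᵖ} {p : (sphereLevel.{u} m n).obj k → Prop}
    (h : ∀ h s, p (sphereMk h s)) (h₀ : p ((sphereLevel.{u} m n).obj k).point)
    (z : (sphereLevel.{u} m n).obj k) : p z := by
  refine Quot.inductionOn (motive := p) z (fun o => ?_)
  rcases o with _ | ⟨s, hs⟩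
  · exact h₀
  · exact h hs s

/-- A pointed map out of `S^n` (if `m ≤ n`) from a function of `n` points of the circle which
sends the fat wedge to the base point. -/
def sphereLift {m n : ℕ} {k : SimplexCategoryᵒᵖ} {A : Pointed.{u}}
    (b : (m ≤ n) → (Fin n → PSSet.S1.{u}.obj k) → A)
    (hb : ∀ h s i, s i = (PSSet.S1.{u}.obj k).point → b h s = A.point) :
    (sphereLevel m n).obj k ⟶ A where
  toFun := Quot.lift (fun o => o.elim A.point (fun s => b s.2 s.1)) (by
    rintro _ _ ⟨h, s, i, hi⟩
    exact hb h s i hi)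
  map_point := rfl

/-- The permutation action of `Σ_n` on `S^n`. -/
def sphereAct (m n : ℕ) : Equiv.Perm (Fin n) →* End (sphereLevel.{u} m n) where
  toFun τ :=
    { app := fun k => sphereLift (fun h s => sphereMk h (fun i => s (τ.symm i)))
        (fun h s i hi => sphereMk_eq_point h _ (τ i) (by simpa using hi))
      naturality := fun k l φ => by
        apply Pointed.Hom.ext
        funext z
        induction z using sphere_induction with
        | h h s => rfl
        | h₀ => rfl }
  map_one' := by
    apply NatTrans.ext
    funext k
    apply Pointed.Hom.ext
    funext z
    induction z using sphere_induction with
    | h h s => rfl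
    | h₀ => rfl
  map_mul' τ π := by
    apply NatTrans.ext
    funext k
    apply Pointed.Hom.ext
    funext z
    induction z using sphere_induction with
    | h h s => rfl
    | h₀ => rfl

/-- The structure map `S^n ∧ S¹ ⟶ S^(n + 1)` on elements. -/
def sphereSig {m n : ℕ} {k : SimplexCategoryᵒᵖ} (z : (sphereLevel.{u} m n).obj k)
    (t : PSSet.S1.{u}.obj k) : (sphereLevel.{u} m (n + 1)).obj k :=
  (sphereLift (fun h s => sphereMk (m := m) (n := n + 1) (by omega)
      (Fin.snoc (α := fun _ => PSSet.S1.{u}.obj k) s t))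
    (fun h s i hi => sphereMk_eq_point _ _ i.castSucc (by simpa using hi))).toFun z

lemma sphereSig_mk {m n : ℕ} {k : SimplexCategoryᵒᵖ} (h : m ≤ n)
    (s : Fin n → PSSet.S1.{u}.obj k) (t : PSSet.S1.{u}.obj k) :
    sphereSig (sphereMk h s) t =
      sphereMk (by omega) (Fin.snoc (α := fun _ => PSSet.S1.{u}.obj k) s t) := rfl

/-- The symmetric spectrum with `n`-th level `S^n` for `m ≤ n` and `*` for `n < m`, with the
permutation actions and the evident structure maps. -/
def sphereFrom (m : ℕ) : SymSpectrum.{u} :=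
  ofElements (sphereLevel m) (sphereAct m) (fun z t => sphereSig z t)
    (fun t => rfl)
    (fun {n k} z => by
      induction z using sphere_induction with
      | h h s => exact sphereMk_eq_point _ _ (Fin.last n) (by simp)
      | h₀ => rfl)
    (fun {n k l} φ z t => by
      induction z using sphere_induction with
      | h h s =>
        refine congrArg (sphereMk (by omega)) ?_
        funext i
        induction i using Fin.lastCases <;> simp
      | h₀ => rfl)
    (fun {n k} τ z t => by
      induction z using sphere_induction with
      | h h s =>
        refine congrArg (sphereMk (by omega)) ?_
        funext i
        obtain ⟨i, rfl⟩ := (succEquiv τ).surjective i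
        rw [Equiv.symm_apply_apply]
        induction i using Fin.lastCases <;> simp
      | h₀ => rfl)
    (fun {n k} z s t => by
      induction z using sphere_induction with
      | h h x =>
        refine congrArg (sphereMk (by omega)) ?_
        funext i
        rw [Equiv.symm_swap]
        induction i using Fin.lastCases with
        | last => simp
        | cast i =>
          induction i using Fin.lastCases with
          | last => simp
          | cast i =>
            rw [Equiv.swap_apply_of_ne_of_ne
              (fun h => (Fin.castSucc_lt_last i).ne (Fin.castSucc_injective _ h))
              (Fin.castSucc_lt_last _).ne]
            simp
      | h₀ => rfl)

/-- The sphere spectrum `S`, with `S(n) = S^n`. -/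
def sphere : SymSpectrum.{u} := sphereFrom 0

/-- The spectrum `S̄`, with `S̄(n) = S^n` for `n ≥ 1` and `S̄(0) = *`. -/
def sphereBar : SymSpectrum.{u} := sphereFrom 1

/-- The inclusion `S̄ ⟶ S`. -/
def sphereBarIncl : sphereBar.{u} ⟶ sphere.{u} :=
  homMk
    (fun n =>
      { app := fun k => sphereLift (fun _ s => sphereMk (Nat.zero_le n) s)
          (fun _ s i hi => sphereMk_eq_point _ s i hi)
        naturality := fun k l φ => by
          apply Pointed.Hom.ext
          funext z
          induction z using sphere_induction with
          | h h s => rfl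
          | h₀ => rfl })
    (fun τ z => by
      induction z using sphere_induction with
      | h h s => rfl
      | h₀ => rfl)
    (fun z t => by
      induction z using sphere_induction with
      | h h s => rfl
      | h₀ => rfl)

/-! #### The smash product of symmetric spectra -/

/-- The bijection `Fin p ⊔ Fin (r + 1) ≃ Fin (p + 1) ⊔ Fin r` moving the last element of the
second summand to the end of the first one. -/
def shiftEquiv (p r : ℕ) : Fin p ⊕ Fin (r + 1) ≃ Fin (p + 1) ⊕ Fin r where
  toFun := Sum.elim (fun i => Sum.inl i.castSucc)
    (Fin.lastCases (Sum.inl (Fin.last p)) (fun j => Sum.inr j))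
  invFun := Sum.elim (Fin.lastCases (Sum.inr (Fin.last r)) (fun i => Sum.inl i))
    (fun j => Sum.inr j.castSucc)
  left_inv := by
    rintro (i | j)
    · simp
    · refine Fin.lastCases ?_ (fun j => ?_) j <;> simp
  right_inv := by
    rintro (i | j)
    · refine Fin.lastCases ?_ (fun j => ?_) i <;> simp
    · simp

@[simp] lemma shiftEquiv_inl (p r : ℕ) (i : Fin p) :
    shiftEquiv p r (Sum.inl i) = Sum.inl i.castSucc := rfl

@[simp] lemma shiftEquiv_inr_last (p r : ℕ) :
    shiftEquiv p r (Sum.inr (Fin.last r)) = Sum.inl (Fin.last p) := by simp [shiftEquiv]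

@[simp] lemma shiftEquiv_inr_castSucc (p r : ℕ) (j : Fin r) :
    shiftEquiv p r (Sum.inr j.castSucc) = Sum.inr j := by simp [shiftEquiv]

/-- The extension of a bijection `Fin p ⊔ Fin r ≃ Fin n` by a last element on both sides. -/
def addLast {p r n : ℕ} (e : Fin p ⊕ Fin r ≃ Fin n) : Fin p ⊕ Fin (r + 1) ≃ Fin (n + 1) where
  toFun := Sum.elim (fun i => (e (Sum.inl i)).castSucc)
    (Fin.lastCases (Fin.last n) (fun j => (e (Sum.inr j)).castSucc))
  invFun := Fin.lastCases (Sum.inr (Fin.last r)) (fun i => Sum.map id Fin.castSucc (e.symm i))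
  left_inv := by
    rintro (i | j)
    · simp
    · refine Fin.lastCases ?_ (fun j => ?_) j <;> simp
  right_inv i := by
    refine Fin.lastCases ?_ (fun j => ?_) i
    · simp
    · obtain ⟨a | a, rfl⟩ := e.surjective j <;> simp

@[simp] lemma addLast_inl {p r n : ℕ} (e : Fin p ⊕ Fin r ≃ Fin n) (i : Fin p) :
    addLast e (Sum.inl i) = (e (Sum.inl i)).castSucc := rfl

@[simp] lemma addLast_inr_last {p r n : ℕ} (e : Fin p ⊕ Fin r ≃ Fin n) :
    addLast e (Sum.inr (Fin.last r)) = Fin.last n := by simp [addLast]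

@[simp] lemma addLast_inr_castSucc {p r n : ℕ} (e : Fin p ⊕ Fin r ≃ Fin n) (j : Fin r) :
    addLast e (Sum.inr j.castSucc) = (e (Sum.inr j)).castSucc := by simp [addLast]

section Smash

/-- Representatives of the `k`-simplices of `(X ∧ Y)(n)`: a decomposition `e` of `{0, …, n - 1}`
into `p` and `r` elements, and elements `x ∈ X(p)`, `y ∈ Y(r)`. Such a triple stands for the
image of `x ∧ y ∈ X(p) ∧ Y(r)` in `(X ∧ Y)(p + r)`, moved by the bijection `e`. -/
structure SmashPre (X Y : SymSpectrum.{u}) (n : ℕ) (k : SimplexCategoryᵒᵖ) : Type u where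
  /-- The level of the first factor. -/
  p : ℕ
  /-- The level of the second factor. -/
  r : ℕ
  /-- The decomposition. -/
  e : Fin p ⊕ Fin r ≃ Fin n
  /-- The first factor. -/
  x : (X.level p).obj k
  /-- The second factor. -/
  y : (Y.level r).obj k

/-- The relation defining the smash product `X ∧ Y` of symmetric spectra. The relations `left`,
`right` and `perm` define the summands `Σ_n₊ ∧_{Σ_p × Σ_r} (X(p) ∧ Y(r))` of the tensor product
of symmetric sequences; the relation `balance` identifies the two maps
`X(p) ∧ S¹ ∧ Y(r) ⟶ (X ∧ Y)(p + 1 + r)` given by the structure maps of `X` and of `Y`. In other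
words, the smash product is the universal target of a bimorphism from `(X, Y)`, or the
coequalizer of `X ⊗ S ⊗ Y ⇉ X ⊗ Y`. -/
inductive SmashRel (X Y : SymSpectrum.{u}) (n : ℕ) (k : SimplexCategoryᵒᵖ) :
    Option (SmashPre X Y n k) → Option (SmashPre X Y n k) → Prop
  | left (p r : ℕ) (e : Fin p ⊕ Fin r ≃ Fin n) (y : (Y.level r).obj k) :
      SmashRel X Y n k (some ⟨p, r, e, ((X.level p).obj k).point, y⟩) none
  | right (p r : ℕ) (e : Fin p ⊕ Fin r ≃ Fin n) (x : (X.level p).obj k) :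
      SmashRel X Y n k (some ⟨p, r, e, x, ((Y.level r).obj k).point⟩) none
  | perm (p r : ℕ) (e : Fin p ⊕ Fin r ≃ Fin n) (α : Equiv.Perm (Fin p)) (β : Equiv.Perm (Fin r))
      (x : (X.level p).obj k) (y : (Y.level r).obj k) :
      SmashRel X Y n k (some ⟨p, r, (Equiv.sumCongr α β).trans e, x, y⟩)
        (some ⟨p, r, e, X.perm α x, Y.perm β y⟩)
  | balance (p r : ℕ) (e : Fin (p + 1) ⊕ Fin r ≃ Fin n) (x : (X.level p).obj k)
      (t : PSSet.S1.{u}.obj k) (y : (Y.level r).obj k) :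
      SmashRel X Y n k (some ⟨p + 1, r, e, X.sig x t, y⟩)
        (some ⟨p, r + 1, (shiftEquiv p r).trans e, x, Y.sig y t⟩)

variable (X Y : SymSpectrum.{u})

/-- The levels of the smash product. -/
def smashLevel (n : ℕ) : PSSet.{u} where
  obj k := Pointed.of (Quot.mk (SmashRel X Y n k) none)
  map {k l} φ := ⟨Quot.map (Option.map fun z => ⟨z.p, z.r, z.e, ((X.level z.p).map φ).toFun z.x,
      ((Y.level z.r).map φ).toFun z.y⟩) (by
    rintro _ _ (⟨p, r, e, y⟩ | ⟨p, r, e, x⟩ | ⟨p, r, e, α, β, x, y⟩ | ⟨p, r, e, x, t, y⟩)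
    · simp only [Option.map_some, Option.map_none, Pointed.Hom.map_point]
      exact SmashRel.left _ _ _ _
    · simp only [Option.map_some, Option.map_none, Pointed.Hom.map_point]
      exact SmashRel.right _ _ _ _
    · simp only [Option.map_some, ← perm_map]
      exact SmashRel.perm _ _ _ _ _ _ _
    · simp only [Option.map_some, ← sig_map]
      exact SmashRel.balance _ _ _ _ _ _), rfl⟩
  map_id k := by
    apply Pointed.Hom.ext
    funext z
    induction z using Quot.inductionOn with
    | h z => cases z <;> simp [Quot.map]
  map_comp φ ψ := by
    apply Pointed.Hom.ext
    funext z
    induction z using Quot.inductionOn with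
    | h z => cases z <;> simp [Quot.map]

variable {X Y}

/-- The class of `(e, x, y)` in `(X ∧ Y)(n)`. -/
def smashMk {p r n : ℕ} {k : SimplexCategoryᵒᵖ} (e : Fin p ⊕ Fin r ≃ Fin n)
    (x : (X.level p).obj k) (y : (Y.level r).obj k) : (smashLevel X Y n).obj k :=
  Quot.mk _ (some ⟨p, r, e, x, y⟩)

lemma smashMk_left {p r n : ℕ} {k : SimplexCategoryᵒᵖ} (e : Fin p ⊕ Fin r ≃ Fin n)
    (y : (Y.level r).obj k) :
    smashMk e ((X.level p).obj k).point y = ((smashLevel X Y n).obj k).point :=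
  Quot.sound (SmashRel.left p r e y)

lemma smashMk_right {p r n : ℕ} {k : SimplexCategoryᵒᵖ} (e : Fin p ⊕ Fin r ≃ Fin n)
    (x : (X.level p).obj k) :
    smashMk e x ((Y.level r).obj k).point = ((smashLevel X Y n).obj k).point :=
  Quot.sound (SmashRel.right p r e x)

lemma smashMk_perm {p r n : ℕ} {k : SimplexCategoryᵒᵖ} (e : Fin p ⊕ Fin r ≃ Fin n)
    (α : Equiv.Perm (Fin p)) (β : Equiv.Perm (Fin r))
    (x : (X.level p).obj k) (y : (Y.level r).obj k) :
    smashMk e (X.perm α x) (Y.perm β y) = smashMk ((Equiv.sumCongr α β).trans e) x y :=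
  (Quot.sound (SmashRel.perm p r e α β x y)).symm

lemma smashMk_perm_right {p r n : ℕ} {k : SimplexCategoryᵒᵖ} (e : Fin p ⊕ Fin r ≃ Fin n)
    (β : Equiv.Perm (Fin r)) (x : (X.level p).obj k) (y : (Y.level r).obj k) :
    smashMk e x (Y.perm β y) = smashMk ((Equiv.sumCongr 1 β).trans e) x y := by
  rw [← smashMk_perm, perm_one]

lemma smashMk_sig {p r n : ℕ} {k : SimplexCategoryᵒᵖ} (e : Fin (p + 1) ⊕ Fin r ≃ Fin n)
    (x : (X.level p).obj k) (t : PSSet.S1.{u}.obj k) (y : (Y.level r).obj k) :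
    smashMk e (X.sig x t) y = smashMk ((shiftEquiv p r).trans e) x (Y.sig y t) :=
  Quot.sound (SmashRel.balance p r e x t y)

lemma smash_induction {n : ℕ} {k : SimplexCategoryᵒᵖ} {P : (smashLevel X Y n).obj k → Prop}
    (h : ∀ (p r : ℕ) (e : Fin p ⊕ Fin r ≃ Fin n) (x : (X.level p).obj k) (y : (Y.level r).obj k),
      P (smashMk e x y)) (h₀ : P ((smashLevel X Y n).obj k).point)
    (z : (smashLevel X Y n).obj k) : P z := by
  refine Quot.inductionOn (motive := P) z (fun o => ?_)
  rcases o with _ | ⟨p, r, e, x, y⟩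
  · exact h₀
  · exact h p r e x y

/-- Pointed maps out of a level of the smash product. -/
def smashLift {n : ℕ} {k : SimplexCategoryᵒᵖ} {A : Pointed.{u}}
    (b : ∀ {p r : ℕ}, (Fin p ⊕ Fin r ≃ Fin n) → (X.level p).obj k → (Y.level r).obj k → A)
    (b_left : ∀ {p r : ℕ} (e : Fin p ⊕ Fin r ≃ Fin n) (y : (Y.level r).obj k),
      b e ((X.level p).obj k).point y = A.point)
    (b_right : ∀ {p r : ℕ} (e : Fin p ⊕ Fin r ≃ Fin n) (x : (X.level p).obj k),
      b e x ((Y.level r).obj k).point = A.point)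
    (b_perm : ∀ {p r : ℕ} (e : Fin p ⊕ Fin r ≃ Fin n) (α : Equiv.Perm (Fin p))
      (β : Equiv.Perm (Fin r)) (x : (X.level p).obj k) (y : (Y.level r).obj k),
      b ((Equiv.sumCongr α β).trans e) x y = b e (X.perm α x) (Y.perm β y))
    (b_sig : ∀ {p r : ℕ} (e : Fin (p + 1) ⊕ Fin r ≃ Fin n) (x : (X.level p).obj k)
      (t : PSSet.S1.{u}.obj k) (y : (Y.level r).obj k),
      b e (X.sig x t) y = b ((shiftEquiv p r).trans e) x (Y.sig y t)) :
    (smashLevel X Y n).obj k ⟶ A where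
  toFun := Quot.lift (fun o => o.elim A.point (fun z => b z.e z.x z.y)) (by
    rintro _ _ (⟨p, r, e, y⟩ | ⟨p, r, e, x⟩ | ⟨p, r, e, α, β, x, y⟩ | ⟨p, r, e, x, t, y⟩)
    · exact b_left e y
    · exact b_right e x
    · exact b_perm e α β x y
    · exact b_sig e x t y)
  map_point := rfl

variable (X Y)

/-- The action of `Σ_n` on `(X ∧ Y)(n)`. -/
def smashAct (n : ℕ) : Equiv.Perm (Fin n) →* End (smashLevel X Y n) where
  toFun τ :=
    { app := fun k => smashLift (fun e x y => smashMk (e.trans τ) x y)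
        (fun e y => smashMk_left _ y) (fun e x => smashMk_right _ x)
        (fun e α β x y => (smashMk_perm (e.trans τ) α β x y).symm)
        (fun e x t y => smashMk_sig _ x t y)
      naturality := fun k l φ => by
        apply Pointed.Hom.ext
        funext z
        induction z using smash_induction with
        | h p r e x y => rfl
        | h₀ => rfl }
  map_one' := by
    apply NatTrans.ext
    funext k
    apply Pointed.Hom.ext
    funext z
    induction z using smash_induction with
    | h p r e x y => rfl
    | h₀ => rfl
  map_mul' τ π := by
    apply NatTrans.ext
    funext k
    apply Pointed.Hom.ext
    funext z
    induction z using smash_induction with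
    | h p r e x y => rfl
    | h₀ => rfl

lemma addLast_sumCongr {p r n : ℕ} (e : Fin p ⊕ Fin r ≃ Fin n) (α : Equiv.Perm (Fin p))
    (β : Equiv.Perm (Fin r)) : addLast ((Equiv.sumCongr α β).trans e) =
      (Equiv.sumCongr α (succEquiv β)).trans (addLast e) := by
  ext i
  rcases i with i | i
  · simp
  · induction i using Fin.lastCases <;> simp

lemma addLast_trans {p r n : ℕ} (e : Fin p ⊕ Fin r ≃ Fin n) (τ : Equiv.Perm (Fin n)) :
    addLast (e.trans τ) = (addLast e).trans (succEquiv τ) := by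
  ext i
  rcases i with i | i
  · simp
  · induction i using Fin.lastCases <;> simp

lemma swap_last_castSucc {n : ℕ} (i : Fin n) :
    Equiv.swap (Fin.last n).castSucc (Fin.last (n + 1)) i.castSucc.castSucc =
      i.castSucc.castSucc :=
  Equiv.swap_apply_of_ne_of_ne
    (fun h => (Fin.castSucc_lt_last i).ne (Fin.castSucc_injective _ h))
    (Fin.castSucc_lt_last _).ne

set_option linter.unusedSimpArgs false in
lemma shiftEquiv_addLast {p r n : ℕ} (e : Fin (p + 1) ⊕ Fin r ≃ Fin n) :
    (shiftEquiv p (r + 1)).trans (addLast e) =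
      (Equiv.sumCongr 1 (Equiv.swap (Fin.last r).castSucc (Fin.last (r + 1)))).trans
        (addLast ((shiftEquiv p r).trans e)) := by
  apply Equiv.ext
  rintro (i | i)
  · simp only [Equiv.trans_apply, Equiv.sumCongr_apply, Sum.map_inl, Sum.map_inr,
        Equiv.Perm.one_apply, swap_last_castSucc, shiftEquiv_inl, shiftEquiv_inr_castSucc,
        addLast_inl, addLast_inr_castSucc]
  · induction i using Fin.lastCases with
    | last => simp
    | cast i =>
      induction i using Fin.lastCases with
      | last => simp
      | cast i => simp only [Equiv.trans_apply, Equiv.sumCongr_apply, Sum.map_inl, Sum.map_inr,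
        Equiv.Perm.one_apply, swap_last_castSucc, shiftEquiv_inl, shiftEquiv_inr_castSucc,
        addLast_inl, addLast_inr_castSucc]

set_option linter.unusedSimpArgs false in
lemma addLast_addLast {p r n : ℕ} (e : Fin p ⊕ Fin r ≃ Fin n) :
    (Equiv.sumCongr 1 (Equiv.swap (Fin.last r).castSucc (Fin.last (r + 1)))).trans
        (addLast (addLast e)) =
      (addLast (addLast e)).trans (Equiv.swap (Fin.last n).castSucc (Fin.last (n + 1))) := by
  apply Equiv.ext
  rintro (i | i)
  · simp only [Equiv.trans_apply, Equiv.sumCongr_apply, Sum.map_inl, Sum.map_inr,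
        Equiv.Perm.one_apply, swap_last_castSucc, shiftEquiv_inl, shiftEquiv_inr_castSucc,
        addLast_inl, addLast_inr_castSucc]
  · induction i using Fin.lastCases with
    | last => simp
    | cast i =>
      induction i using Fin.lastCases with
      | last => simp
      | cast i => simp only [Equiv.trans_apply, Equiv.sumCongr_apply, Sum.map_inl, Sum.map_inr,
        Equiv.Perm.one_apply, swap_last_castSucc, shiftEquiv_inl, shiftEquiv_inr_castSucc,
        addLast_inl, addLast_inr_castSucc]

/-- The structure map of the smash product on elements. -/
def smashSig {n : ℕ} {k : SimplexCategoryᵒᵖ} (z : (smashLevel X Y n).obj k)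
    (t : PSSet.S1.{u}.obj k) : (smashLevel X Y (n + 1)).obj k :=
  (smashLift (fun e x y => smashMk (addLast e) x (Y.sig y t))
    (fun e y => smashMk_left _ _)
    (fun e x => by rw [sig_point_left]; exact smashMk_right _ x)
    (fun e α β x y => by rw [sig_perm, smashMk_perm, addLast_sumCongr])
    (fun e x s y => by
      rw [smashMk_sig, sig_sig, smashMk_perm_right, shiftEquiv_addLast, ← Equiv.trans_assoc]
      congr 1
      apply Equiv.ext
      rintro (i | i) <;> simp)).toFun z

/-- The smash product of two symmetric spectra. -/
def smash : SymSpectrum.{u} :=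
  ofElements (smashLevel X Y) (smashAct X Y) (fun z t => smashSig X Y z t)
    (fun t => rfl)
    (fun {n k} z => by
      induction z using smash_induction with
      | h p r e x y =>
        exact (congrArg (smashMk (addLast e) x) (Y.sig_point_right y)).trans (smashMk_right _ x)
      | h₀ => rfl)
    (fun {n k l} φ z t => by
      induction z using smash_induction with
      | h p r e x y =>
        exact congrArg (smashMk (addLast e) (((X.level p).map φ).toFun x)) (Y.sig_map φ y t)
      | h₀ => rfl)
    (fun {n k} τ z t => by
      induction z using smash_induction with
      | h p r e x y =>
        exact congrArg (fun e' => smashMk e' x (Y.sig y t)) (addLast_trans e τ)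
      | h₀ => rfl)
    (fun {n k} z s t => by
      induction z using smash_induction with
      | h p r e x y =>
        have h := smashMk_perm_right (addLast (addLast e))
          (Equiv.swap (Fin.last r).castSucc (Fin.last (r + 1))) x (Y.sig (Y.sig y t) s)
        rw [← sig_sig, addLast_addLast] at h
        exact h
      | h₀ => rfl)

variable {X Y}

/-- The smash product of two morphisms. -/
def smashMap {X' Y' : SymSpectrum.{u}} (f : X ⟶ X') (g : Y ⟶ Y') : smash X Y ⟶ smash X' Y' :=
  homMk
    (fun n =>
      { app := fun k => smashLift (A := (smashLevel X' Y' n).obj k)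
          (fun {p r} e x y => smashMk e (((f.app p).app k).toFun x) (((g.app r).app k).toFun y))
          (fun e y => by rw [Pointed.Hom.map_point]; exact smashMk_left _ _)
          (fun e x => by rw [Pointed.Hom.map_point]; exact smashMk_right _ _)
          (fun e α β x y => by rw [Hom.app_perm, Hom.app_perm, smashMk_perm])
          (fun e x t y => by rw [Hom.app_sig, Hom.app_sig, smashMk_sig])
        naturality := fun k l φ => by
          apply Pointed.Hom.ext
          funext z
          induction z using smash_induction with
          | h p r e x y =>
            exact congrArg₂ (smashMk e) (PSSet.naturality_apply (f.app p) φ x)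
              (PSSet.naturality_apply (g.app r) φ y)
          | h₀ => rfl })
    (fun τ z => by
      induction z using smash_induction with
      | h p r e x y => rfl
      | h₀ => rfl)
    (fun z t => by
      induction z using smash_induction with
      | h p r e x y =>
        exact congrArg (smashMk (addLast e) _) (Hom.app_sig g y t)
      | h₀ => rfl)

end Smash

/-! #### The unit isomorphism of the sphere spectrum and the latching maps -/

section Latching

/-- The bijection which moves the last element of `Fin (n + m + 1)` to position `n`. -/
def rotEquiv (n : ℕ) : (m : ℕ) → Fin (n + m + 1) ≃ Fin (n + 1 + m)
  | 0 => Equiv.refl _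
  | m + 1 => (Equiv.swap (Fin.last (n + m)).castSucc (Fin.last (n + m + 1))).trans
      (succEquiv (rotEquiv n m))

lemma rotEquiv_val (n m : ℕ) (i : Fin (n + m + 1)) :
    (rotEquiv n m i).val = if i.val < n then i.val else if i.val < n + m then i.val + 1 else n := by
  induction m with
  | zero =>
    have := i.isLt
    simp only [rotEquiv, Equiv.refl_apply]
    split_ifs <;> omega
  | succ m ih =>
    have h : ∀ i : Fin (n + m + 1 + 1), (succEquiv (rotEquiv n m)
        (Equiv.swap (Fin.last (n + m)).castSucc (Fin.last (n + m + 1)) i)).val =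
        if i.val < n then i.val else if i.val < n + m + 1 then i.val + 1 else n := by
      intro i
      induction i using Fin.lastCases with
      | last =>
        rw [Equiv.swap_apply_right, succEquiv_castSucc, Fin.val_castSucc, ih]
        simp
        omega
      | cast i =>
        induction i using Fin.lastCases with
        | last =>
          rw [Equiv.swap_apply_left, succEquiv_last]
          simp
          omega
        | cast i =>
          rw [swap_last_castSucc, succEquiv_castSucc, Fin.val_castSucc, ih]
          simp only [Fin.val_castSucc]
          have := i.isLt
          split_ifs <;> omega
    exact h i

lemma iter_sig (X : SymSpectrum.{u}) {k : SimplexCategoryᵒᵖ} {n : ℕ} (x : (X.level n).obj k)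
    (t : PSSet.S1.{u}.obj k) (m : ℕ) (s : Fin m → PSSet.S1.{u}.obj k) :
    X.iter (X.sig x t) m s = X.mapE (rotEquiv n m) (X.sig (X.iter x m s) t) := by
  induction m with
  | zero => exact (X.perm_one _).symm
  | succ m ih =>
    rw [iter, ih, sig_mapE, rotEquiv, mapE_trans, sig_sig]
    rfl

/-- The bijection `Fin (r + p) ≃ Fin n` associated to a decomposition. -/
def flipEquiv {p r n : ℕ} (e : Fin p ⊕ Fin r ≃ Fin n) : Fin (r + p) ≃ Fin n :=
  finSumFinEquiv.symm.trans ((Equiv.sumComm _ _).trans e)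

@[simp] lemma flipEquiv_castAdd {p r n : ℕ} (e : Fin p ⊕ Fin r ≃ Fin n) (i : Fin r) :
    flipEquiv e (Fin.castAdd p i) = e (Sum.inr i) := by simp [flipEquiv]

@[simp] lemma flipEquiv_natAdd {p r n : ℕ} (e : Fin p ⊕ Fin r ≃ Fin n) (i : Fin p) :
    flipEquiv e (Fin.natAdd r i) = e (Sum.inl i) := by simp [flipEquiv]

lemma flipEquiv_sumCongr {p r n : ℕ} (e : Fin p ⊕ Fin r ≃ Fin n) (α : Equiv.Perm (Fin p))
    (β : Equiv.Perm (Fin r)) :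
    flipEquiv ((Equiv.sumCongr α β).trans e) = Equiv.trans (blockSum β α) (flipEquiv e) := by
  ext i
  induction i using Fin.addCases <;> simp

lemma rotEquiv_flipEquiv {p r n : ℕ} (e : Fin (p + 1) ⊕ Fin r ≃ Fin n) :
    (rotEquiv r p).trans (flipEquiv ((shiftEquiv p r).trans e)) = flipEquiv e := by
  apply Equiv.ext
  intro i
  rw [Equiv.trans_apply]
  induction i using Fin.addCases (m := r) (n := p + 1) with
  | left i =>
    have h : rotEquiv r p (Fin.castAdd (p + 1) i) = Fin.castAdd p i.castSucc := by
      apply Fin.ext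
      rw [rotEquiv_val]
      simp
    rw [h, flipEquiv_castAdd, flipEquiv_castAdd]
    simp
  | right i =>
    induction i using Fin.lastCases with
    | last =>
      have h : rotEquiv r p (Fin.natAdd r (Fin.last p)) = Fin.castAdd p (Fin.last r) := by
        apply Fin.ext
        rw [rotEquiv_val]
        simp
      rw [h, flipEquiv_castAdd, flipEquiv_natAdd]
      simp
    | cast i =>
      have h : rotEquiv r p (Fin.natAdd r i.castSucc) = Fin.natAdd (r + 1) i := by
        apply Fin.ext
        rw [rotEquiv_val]
        simp
        omega
      rw [h, flipEquiv_natAdd, flipEquiv_natAdd]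
      simp

variable {X Y : SymSpectrum.{u}}

/-- The map `S^p ⟶ X(n)` sending `s` to the image of `σ^p(x, s)` under the bijection `e`. -/
def unitAux {p r n : ℕ} {k : SimplexCategoryᵒᵖ} (e : Fin p ⊕ Fin r ≃ Fin n)
    (x : (X.level r).obj k) : (sphere.{u}.level p).obj k ⟶ (X.level n).obj k :=
  sphereLift (fun _ s => X.mapE (flipEquiv e) (X.iter x p s))
    (fun _ s i hi => by rw [iter_point_right X x p s i hi, mapE_point])

/-- The canonical isomorphism `(S ∧ X)(n) ⟶ X(n)`. -/
def leftUnit (X : SymSpectrum.{u}) (n : ℕ) : (smash sphere X).level n ⟶ X.level n where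
  app k := smashLift (X := sphere) (Y := X) (fun e s x => (unitAux e x).toFun s)
    (fun e x => Pointed.Hom.map_point _)
    (fun e s => by
      induction s using sphere_induction with
      | h h s =>
        exact (congrArg (X.mapE (flipEquiv e)) (X.iter_point _ s)).trans (X.mapE_point _)
      | h₀ => rfl)
    (fun e α β s x => by
      induction s using sphere_induction with
      | h h s =>
        have h1 : X.mapE (flipEquiv ((Equiv.sumCongr α β).trans e)) (X.iter x _ s) =
            X.mapE (flipEquiv e) (X.iter (X.perm β x) _ (fun i => s (α.symm i))) := by
          rw [iter_act, flipEquiv_sumCongr, mapE_trans, mapE_perm]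
        exact h1
      | h₀ => rfl)
    (fun {p r} e s t x => by
      induction s using sphere_induction with
      | h h s =>
        have h1 : X.mapE (flipEquiv e) (X.iter x (p + 1)
            (Fin.snoc (α := fun _ => PSSet.S1.{u}.obj k) s t)) =
            X.mapE (flipEquiv ((shiftEquiv p r).trans e)) (X.iter (X.sig x t) p s) := by
          rw [iter_sig, ← mapE_trans, rotEquiv_flipEquiv, iter]
          simp only [Fin.snoc_castSucc, Fin.snoc_last]
        exact h1
      | h₀ => rfl)
  naturality k l φ := by
    apply Pointed.Hom.ext
    funext z
    induction z using smash_induction with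
    | h p r e s x =>
      induction s using sphere_induction with
      | h h s =>
        have h1 : X.mapE (flipEquiv e) (X.iter (((X.level r).map φ).toFun x) p
            (fun i => (PSSet.S1.{u}.map φ).toFun (s i))) =
            ((X.level n).map φ).toFun (X.mapE (flipEquiv e) (X.iter x p s)) := by
          rw [iter_map, mapE_map]
        exact h1
      | h₀ => exact (Pointed.Hom.map_point ((X.level n).map φ)).symm
    | h₀ => exact (Pointed.Hom.map_point ((X.level n).map φ)).symm

/-- The latching object `L_n X = (S̄ ∧ X)(n)` of a symmetric spectrum. -/
def latch (X : SymSpectrum.{u}) (n : ℕ) : PSSet.{u} := (smash sphereBar X).level n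

/-- The map `L_n X ⟶ L_n Y` induced by a morphism `X ⟶ Y`. -/
def latchMap (f : X ⟶ Y) (n : ℕ) : latch X n ⟶ latch Y n := (smashMap (𝟙 sphereBar) f).app n

/-- The map `ν_n : L_n X = (S̄ ∧ X)(n) ⟶ (S ∧ X)(n) ≅ X(n)`. -/
def latchToLevel (X : SymSpectrum.{u}) (n : ℕ) : latch X n ⟶ X.level n :=
  (smashMap sphereBarIncl (𝟙 X)).app n ≫ leftUnit X n

lemma latchToLevel_naturality (f : X ⟶ Y) (n : ℕ) :
    latchToLevel X n ≫ f.app n = latchMap f n ≫ latchToLevel Y n := by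
  apply NatTrans.ext
  funext k
  apply Pointed.Hom.ext
  funext z
  induction z using smash_induction with
  | h p r e s x =>
    induction s using sphere_induction with
    | h h s =>
      have h1 : ((f.app n).app k).toFun (X.mapE (flipEquiv e) (X.iter x p s)) =
          Y.mapE (flipEquiv e) (Y.iter (((f.app r).app k).toFun x) p s) := by
        rw [Hom.app_mapE, Hom.app_iter]
      exact h1
    | h₀ => exact Pointed.Hom.map_point ((f.app n).app k)
  | h₀ => exact Pointed.Hom.map_point ((f.app n).app k)

end Latching

/-! #### Smash products with pointed simplicial sets and geometric realization -/

section Tensor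

variable (X : SymSpectrum.{u}) (L : PSSet.{u})

/-- The structure map of `X ∧ L` on elements, `(x ∧ l, t) ↦ σ(x, t) ∧ l`. -/
def tensorSig {n : ℕ} {k : SimplexCategoryᵒᵖ} (z : (PSSet.smash (X.level n) L).obj k)
    (t : PSSet.S1.{u}.obj k) : (PSSet.smash (X.level (n + 1)) L).obj k :=
  (Pointed.smash.map (A := (X.level n).obj k) (C := (X.level (n + 1)).obj k)
    ⟨fun x => X.sig x t, X.sig_point_left t⟩ (𝟙 (L.obj k))).toFun z

/-- The symmetric spectrum `X ∧ L`, with levels `X(n) ∧ L`. -/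
def tensor : SymSpectrum.{u} :=
  ofElements (fun n => PSSet.smash (X.level n) L)
    (fun n =>
      { toFun := fun τ => PSSet.smashMap (X.act n τ) (𝟙 L)
        map_one' := by
          rw [map_one]
          exact PSSet.smashMap_id _ _
        map_mul' := fun τ π => by
          rw [map_mul]
          exact PSSet.smashMap_id_comp _ _ })
    (fun z t => tensorSig X L z t)
    (fun {n k} t => by
      exact Pointed.Hom.map_point _)
    (fun {n k} z => by
      induction z using Quot.inductionOn with
      | h z =>
        exact (congrArg (fun x => Pointed.smash.mk x z.2) (X.sig_point_right z.1)).trans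
          (Pointed.smash.mk_point_left _))
    (fun {n k l} φ z t => by
      induction z using Quot.inductionOn with
      | h z =>
        exact congrArg (fun x => Pointed.smash.mk x ((L.map φ).toFun z.2)) (X.sig_map φ z.1 t))
    (fun {n k} τ z t => by
      induction z using Quot.inductionOn with
      | h z => exact congrArg (fun x => Pointed.smash.mk x z.2) (X.sig_perm τ z.1 t))
    (fun {n k} z s t => by
      induction z using Quot.inductionOn with
      | h z => exact congrArg (fun x => Pointed.smash.mk x z.2) (X.sig_sig z.1 s t))

variable {X L}

/-- The morphism `f ∧ g : X ∧ L ⟶ Y ∧ M`. -/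
def tensorMap {Y : SymSpectrum.{u}} {M : PSSet.{u}} (f : X ⟶ Y) (g : L ⟶ M) :
    tensor X L ⟶ tensor Y M :=
  homMk (fun n => PSSet.smashMap (f.app n) g)
    (fun τ z => by
      induction z using Quot.inductionOn with
      | h z => exact congrArg (fun x => Pointed.smash.mk x _) (Hom.app_perm f τ z.1))
    (fun z t => by
      induction z using Quot.inductionOn with
      | h z => exact congrArg (fun x => Pointed.smash.mk x _) (Hom.app_sig f z.1 t))

/-- The bifunctor `(X, L) ↦ X ∧ L`. -/
def tensorFunctor : SymSpectrum.{u} ⥤ PSSet.{u} ⥤ SymSpectrum.{u} where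
  obj X :=
    { obj := fun L => tensor X L
      map := fun g => tensorMap (𝟙 X) g
      map_id := fun L => by
        apply hom_ext
        intro n
        exact PSSet.smashMap_id _ _
      map_comp := fun g h => by
        apply hom_ext
        intro n
        apply NatTrans.ext
        funext k
        exact Pointed.smash.hom_ext fun x y => rfl }
  map f :=
    { app := fun L => tensorMap f (𝟙 L)
      naturality := fun L M g => by
        apply hom_ext
        intro n
        apply NatTrans.ext
        funext k
        exact Pointed.smash.hom_ext fun x y => rfl }
  map_id X := by
    apply NatTrans.ext
    funext L
    apply hom_ext
    intro n
    exact PSSet.smashMap_id _ _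
  map_comp f g := by
    apply NatTrans.ext
    funext L
    apply hom_ext
    intro n
    exact PSSet.smashMap_id_comp _ _

/-- The bifunctor `([m], [k]) ↦ X_m ∧ Δ[k]₊`, natural in the simplicial spectrum `X`. -/
def realizationDiagram : SimplicialObject SymSpectrum.{u} ⥤
    (SimplexCategoryᵒᵖ ⥤ SimplexCategory ⥤ SymSpectrum.{u}) :=
  (Functor.whiskeringRight _ _ _).obj
    (tensorFunctor ⋙ (Functor.whiskeringLeft _ _ _).obj (SSet.stdSimplex.{u} ⋙ PSSet.plus))

/-- The geometric realization `|X| = ∫^[m] X_m ∧ Δ[m]₊` of a simplicial symmetric spectrum. -/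
noncomputable def realization (X : SimplicialObject SymSpectrum.{u}) : SymSpectrum.{u} :=
  coend (realizationDiagram.obj X)

/-- The map `|f| : |X| ⟶ |Y|`. -/
noncomputable def realizationMap {X Y : SimplicialObject SymSpectrum.{u}} (f : X ⟶ Y) :
    realization X ⟶ realization Y :=
  coend.map (realizationDiagram.map f)

end Tensor

/-! #### Flat cofibrations -/

/-- The latching comparison map `X(n) ⊔_{L_n X} L_n Y ⟶ Y(n)` of a morphism `f : X ⟶ Y`. -/
noncomputable def latchComparison {X Y : SymSpectrum.{u}} (f : X ⟶ Y) (n : ℕ) :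
    pushout (latchToLevel X n) (latchMap f n) ⟶ Y.level n :=
  pushout.desc (f.app n) (latchToLevel Y n) (latchToLevel_naturality f n)

/-- Flat cofibrations: all the latching comparison maps are cofibrations, that is, monomorphisms,
of pointed simplicial sets. -/
def flatCofibration : MorphismProperty SymSpectrum.{u} :=
  fun _ _ f => ∀ n : ℕ, Mono (latchComparison f n)

/-- Positive flat cofibrations: flat cofibrations which are isomorphisms in level `0`. -/
def positiveFlatCofibration : MorphismProperty SymSpectrum.{u} :=
  fun _ _ f => flatCofibration f ∧ IsIso (f.app 0)

end SymSpectrum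

/-! ### Latching objects of simplicial objects and Reedy cofibrations -/

namespace Reedy

open scoped ZeroObject

variable {C : Type*} [Category C] [HasZeroObject C] [HasFiniteColimits C]

/-- The object of `n`-simplices. -/
abbrev simplices (X : SimplicialObject C) (n : ℕ) : C := X.obj (op (SimplexCategory.mk n))

/-- The indices of the relations between double degeneracies: `(i, j)` with `i ≤ j ≤ n` stands for
the pair `(i, j + 1)`, so that the pairs `a < b` with `0 ≤ a < b ≤ n + 1` are indexed. -/
abbrev Pairs (n : ℕ) : Type := {p : Fin (n + 1) × Fin (n + 1) // p.1 ≤ p.2}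

/-- The map `∐_{0 ≤ a < b ≤ n + 1} X_n {a, b} ⟶ ∐_{0 ≤ c ≤ n + 1} X_{n + 1} {c}` given by `s_a`
into the summand `b`. -/
noncomputable def latchFst (X : SimplicialObject C) (n : ℕ) :
    (∐ fun _ : Pairs n => simplices X n) ⟶ ∐ fun _ : Fin (n + 2) => simplices X (n + 1) :=
  Sigma.desc fun p => X.σ p.1.1 ≫ Sigma.ι (fun _ : Fin (n + 2) => simplices X (n + 1)) p.1.2.succ

/-- The map `∐_{0 ≤ a < b ≤ n + 1} X_n {a, b} ⟶ ∐_{0 ≤ c ≤ n + 1} X_{n + 1} {c}` given by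
`s_{b - 1}` into the summand `a`. -/
noncomputable def latchSnd (X : SimplicialObject C) (n : ℕ) :
    (∐ fun _ : Pairs n => simplices X n) ⟶ ∐ fun _ : Fin (n + 2) => simplices X (n + 1) :=
  Sigma.desc fun p =>
    X.σ p.1.2 ≫ Sigma.ι (fun _ : Fin (n + 2) => simplices X (n + 1)) p.1.1.castSucc

/-- The latching object of a simplicial object: the zero object for `n = 0`, the object `X_0` for
`n = 1`, and the coequalizer of the two maps above for `n ≥ 2`. -/
noncomputable def latch (X : SimplicialObject C) : ℕ → C
  | 0 => 0
  | 1 => simplices X 0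
  | n + 2 => coequalizer (latchFst X n) (latchSnd X n)

/-- The map from the coequalizer to `X_{n + 2}` given by the degeneracies. -/
noncomputable def latchToSimplicesAux (X : SimplicialObject C) (n : ℕ) :
    coequalizer (latchFst X n) (latchSnd X n) ⟶ simplices X (n + 2) :=
  coequalizer.desc (Sigma.desc fun c : Fin (n + 2) => X.σ c) (by
    apply Sigma.hom_ext
    intro p
    simp [latchFst, latchSnd, SimplicialObject.σ_comp_σ X p.2])

/-- The latching map from the latching object to `X_n`, given by the degeneracies. -/
noncomputable def latchToSimplices (X : SimplicialObject C) : (n : ℕ) → (latch X n ⟶ simplices X n)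
  | 0 => (isZero_zero C).to_ _
  | 1 => X.σ 0
  | n + 2 => latchToSimplicesAux X n

lemma latchFst_naturality {X Y : SimplicialObject C} (f : X ⟶ Y) (n : ℕ) :
    latchFst X n ≫ Limits.Sigma.map (fun _ => f.app _) =
      Limits.Sigma.map (fun _ => f.app _) ≫ latchFst Y n := by
  apply Sigma.hom_ext
  intro p
  simp [latchFst, SimplicialObject.σ]

lemma latchSnd_naturality {X Y : SimplicialObject C} (f : X ⟶ Y) (n : ℕ) :
    latchSnd X n ≫ Limits.Sigma.map (fun _ => f.app _) =
      Limits.Sigma.map (fun _ => f.app _) ≫ latchSnd Y n := by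
  apply Sigma.hom_ext
  intro p
  simp [latchSnd, SimplicialObject.σ]

/-- The map of coequalizers induced by a morphism of simplicial objects. -/
noncomputable def latchMapAux {X Y : SimplicialObject C} (f : X ⟶ Y) (n : ℕ) :
    coequalizer (latchFst X n) (latchSnd X n) ⟶ coequalizer (latchFst Y n) (latchSnd Y n) :=
  coequalizer.desc
    (Limits.Sigma.map (fun _ => f.app _) ≫ coequalizer.π (latchFst Y n) (latchSnd Y n)) (by
      rw [← Category.assoc, latchFst_naturality, Category.assoc, coequalizer.condition,
        ← Category.assoc, ← latchSnd_naturality, Category.assoc])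

/-- Functoriality of the latching objects. -/
noncomputable def latchMap {X Y : SimplicialObject C} (f : X ⟶ Y) : (n : ℕ) → (latch X n ⟶ latch Y n)
  | 0 => 𝟙 _
  | 1 => f.app _
  | n + 2 => latchMapAux f n

lemma latchMapAux_naturality {X Y : SimplicialObject C} (f : X ⟶ Y) (n : ℕ) :
    latchToSimplicesAux X n ≫ f.app (op (SimplexCategory.mk (n + 2))) =
      latchMapAux f n ≫ latchToSimplicesAux Y n := by
  apply coequalizer.hom_ext
  apply Sigma.hom_ext
  intro c
  simp [latchToSimplicesAux, latchMapAux, SimplicialObject.σ]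

lemma latchToSimplices_naturality {X Y : SimplicialObject C} (f : X ⟶ Y) (n : ℕ) :
    latchToSimplices X n ≫ f.app (op (SimplexCategory.mk n)) =
      latchMap f n ≫ latchToSimplices Y n := by
  match n with
  | 0 => exact (isZero_zero C).eq_of_src _ _
  | 1 => exact (f.naturality _)
  | n + 2 =>
    exact latchMapAux_naturality f n

/-- The relative latching map `X_n ⊔_{L_n X} L_n Y ⟶ Y_n`. -/
noncomputable def comparison {X Y : SimplicialObject C} (f : X ⟶ Y) (n : ℕ) :
    pushout (latchToSimplices X n) (latchMap f n) ⟶ simplices Y n :=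
  pushout.desc (f.app _) (latchToSimplices Y n) (latchToSimplices_naturality f n)

/-- Reedy cofibrations with respect to a class `W` of cofibrations: all the relative latching maps
are in `W`. -/
def IsCofibration (W : MorphismProperty C) {X Y : SimplicialObject C} (f : X ⟶ Y) : Prop :=
  ∀ n : ℕ, W (comparison f n)

/-- Reedy cofibrant objects with respect to a class `W` of cofibrations: all the latching maps
are in `W`. -/
def IsCofibrant (W : MorphismProperty C) (X : SimplicialObject C) : Prop :=
  ∀ n : ℕ, W (latchToSimplices X n)

/-- The map `f` is pointwise in `W`. -/
def IsPointwise (W : MorphismProperty C) {X Y : SimplicialObject C} (f : X ⟶ Y) : Prop :=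
  ∀ n : ℕ, W (f.app (op (SimplexCategory.mk n)))

end Reedy

/-! Everything is checked on elements: a level `m` and a simplicial degree `k` are fixed, and the
objects become pointed sets. A pushout of pointed sets identifies only what comes from the common
source, so injectivity of a latching comparison map is a statement about images. This gives a
criterion (`flatCofibration_of_injective`): a morphism `f` with target `Y` is a flat cofibration if
it is injective, the latching maps `L_m Y → Y(m)` are injective, and `f` reflects their images.
Conversely, every flat cofibration reflects the images of the latching maps
(`flatCofibration.mem_range_nuAt`), and it is injective when its target is flat
(`flatCofibration.mapAt_injective`). The last fact is proved by induction on the level, by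
constructing a retraction of `L_m f` that collapses every `s ∧ y` with `y` not in the image of `f`.

In the Reedy direction the simplicial identities do the work. Degeneracies are split injections, and
an equality `s_i x = s_{j+1} y` with `i ≤ j` forces `x` and `y` to be degeneracies of one common
simplex. So the Reedy latching object embeds in `X_n` as the degenerate simplices
(`mapAt_latchToSimplices_injective`). A map of pointed simplicial sets that identifies at most
degenerate simplices is injective (`PSSet.app_injective_of_degenerate`); applied to `n ↦ (L_m X_n →
X_n(m))_k`, this shows that a Reedy flat-cofibrant object has flat terms
(`nuAt_injective_of_isCofibrant`). Hence a pointwise flat cofibration `f` is injective. An injective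
simplicial map reflects degenerate simplices, so `X_n` and the latching object of `Y` meet in `Y_n`
exactly in the latching object of `X`, and the relative latching map is injective. The criterion
then makes it a flat cofibration, since its restrictions to `X_n` and to the latching object of `Y`
both reflect latching images.

For the realization, the coend is identified with the diagonal `k ↦ X_k(m)_k` (`realizationIso`).
The `k`-simplices of `|X|` are thus those of `X_k`, compatibly with permutations and structure maps,
though not by a map of spectra `|X| → X_k`. Latching maps in degree `k` use only this structure
(`SimplexwiseHom`), so the three conditions of the criterion pass from `f_k` to `|f|`. In the
positive case the level-`0` maps are moreover bijective degree by degree. -/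

namespace Pointed

/-! ### Pushouts and isomorphisms of pointed sets, on elements. -/

lemma mono_of_injective {A B : Pointed.{u}} (f : A ⟶ B) (hf : Function.Injective f.toFun) :
    Mono f where
  right_cancellation g h hgh := by
    apply Pointed.Hom.ext
    funext x
    exact hf (congrFun (congrArg Pointed.Hom.toFun hgh) x)

lemma isIso_iff_bijective {A B : Pointed.{u}} (f : A ⟶ B) :
    IsIso f ↔ Function.Bijective f.toFun := by
  constructor
  · intro h
    refine Function.bijective_iff_has_inverse.mpr ⟨(inv f).toFun, fun x => ?_, fun y => ?_⟩
    · exact congrFun (congrArg Pointed.Hom.toFun (IsIso.hom_inv_id f)) x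
    · exact congrFun (congrArg Pointed.Hom.toFun (IsIso.inv_hom_id f)) y
  · intro h
    exact (Pointed.Iso.mk (Equiv.ofBijective f.toFun h) f.map_point).isIso_hom

/-- The elements of a colimit of pointed sets come from the diagram. -/
lemma exists_of_isColimit {J : Type} [SmallCategory J] {F : J ⥤ Pointed.{u}} {c : Cocone F}
    (hc : IsColimit c) (z : c.pt) : (∃ j x, (c.ι.app j).toFun x = z) ∨ z = c.pt.point := by
  let φ := (colimCoconeIsColimit F).coconePointUniqueUpToIso hc
  have hφ : φ.hom.toFun (φ.inv.toFun z) = z :=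
    congrFun (congrArg Pointed.Hom.toFun φ.inv_hom_id) z
  rw [← hφ]
  induction φ.inv.toFun z using colim_induction with
  | h j x =>
    refine Or.inl ⟨j, x, ?_⟩
    exact congrFun (congrArg Pointed.Hom.toFun
      ((colimCoconeIsColimit F).comp_coconePointUniqueUpToIso_hom hc j).symm) x
  | h₀ => exact Or.inr φ.hom.map_point

section Pushout

variable {C A B P : Pointed.{u}} {g : C ⟶ A} {h : C ⟶ B} {i : A ⟶ P} {j : B ⟶ P}

lemma pushout_cases (sq : IsPushout g h i j) (z : P) :
    (∃ a, i.toFun a = z) ∨ ∃ b, j.toFun b = z := by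
  rcases exists_of_isColimit sq.isColimit z with ⟨_ | _ | _, x, hx⟩ | hz
  · refine Or.inl ⟨g.toFun x, ?_⟩
    rw [← hx]
    exact congrFun (congrArg Pointed.Hom.toFun (sq.cocone.w WalkingSpan.Hom.fst)) x
  · exact Or.inl ⟨x, hx⟩
  · exact Or.inr ⟨x, hx⟩
  · exact Or.inl ⟨A.point, i.map_point.trans hz.symm⟩

open Classical in
/-- In a pushout of `A` and `B` over `C`, only elements of `B` in the image of `C` are identified. -/
lemma pushout_inr_eq_inr (sq : IsPushout g h i j) {b b' : B} (e : j.toFun b = j.toFun b') :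
    b = b' ∨ (b ∈ Set.range h.toFun ∧ b' ∈ Set.range h.toFun) := by
  -- The test map on the pushout kills `A` and is injective on `B` outside the image of `C`.
  let q : B ⟶ Pointed.of (none : Option B) :=
    ⟨fun b => if b ∈ Set.range h.toFun then none else some b,
      if_pos ⟨C.point, h.map_point⟩⟩
  let p : A ⟶ Pointed.of (none : Option B) := ⟨fun _ => none, rfl⟩
  have w : g ≫ p = h ≫ q := by
    apply Pointed.Hom.ext
    funext c
    exact (if_pos ⟨c, rfl⟩).symm
  have hq : j ≫ sq.desc p q w = q := sq.inr_desc _ _ _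
  have e' : q.toFun b = q.toFun b' := by
    rw [← hq]
    exact congrArg (sq.desc p q w).toFun e
  change (if _ then _ else _) = (if _ then _ else _) at e'
  split_ifs at e' with h₁ h₂ h₂
  · exact Or.inr ⟨h₁, h₂⟩
  · exact Or.inl (Option.some.inj e')

open Classical in
-- Mapping the pushout to `A` with the image of `C` collapsed, and `B` to the base point, sends `j
-- b` to the base point; an `a` outside the image of `C` would survive.
lemma pushout_inl_eq_inr (sq : IsPushout g h i j) {a : A} {b : B} (e : i.toFun a = j.toFun b) :
    a ∈ Set.range g.toFun := by
  let q : A ⟶ Pointed.of (none : Option A) :=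
    ⟨fun a => if a ∈ Set.range g.toFun then none else some a,
      if_pos ⟨C.point, g.map_point⟩⟩
  let p : B ⟶ Pointed.of (none : Option A) := ⟨fun _ => none, rfl⟩
  have w : g ≫ q = h ≫ p := by
    apply Pointed.Hom.ext
    funext c
    exact if_pos ⟨c, rfl⟩
  have hq : i ≫ sq.desc q p w = q := sq.inl_desc _ _ _
  have hp : j ≫ sq.desc q p w = p := sq.inr_desc _ _ _
  have e' : q.toFun a = p.toFun b :=
    (congrFun (congrArg Pointed.Hom.toFun hq) a).symm.trans
      ((congrArg (sq.desc q p w).toFun e).trans (congrFun (congrArg Pointed.Hom.toFun hp) b))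
  by_contra ha
  exact Option.some_ne_none _ ((if_neg ha).symm.trans e')

open Classical in
-- When `h` is injective, `g` extends along `h` to all of `B` by the base point off the image.
-- Gluing this extension with the identity of `A` gives a retraction of `i`.
lemma pushout_inl_injective (sq : IsPushout g h i j) (hh : Function.Injective h.toFun) :
    Function.Injective i.toFun := by
  let q : B ⟶ A :=
    ⟨fun b => if hb : ∃ c, h.toFun c = b then g.toFun hb.choose else A.point, by
      have hb : ∃ c, h.toFun c = B.point := ⟨C.point, h.map_point⟩
      rw [dif_pos hb, hh (hb.choose_spec.trans h.map_point.symm), g.map_point]⟩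
  have w : g ≫ 𝟙 A = h ≫ q := by
    apply Pointed.Hom.ext
    funext c
    have hb : ∃ c', h.toFun c' = h.toFun c := ⟨c, rfl⟩
    refine Eq.trans ?_ (dif_pos hb).symm
    rw [hh hb.choose_spec]
    rfl
  have hq : i ≫ sq.desc (𝟙 A) q w = 𝟙 A := sq.inl_desc _ _ _
  intro a a' e
  have := congrArg (sq.desc (𝟙 A) q w).toFun e
  have hq' := fun a => congrFun (congrArg Pointed.Hom.toFun hq) a
  exact (hq' a).symm.trans (this.trans (hq' a'))

/-- The hypothesis `hft` says that the images of `A` and `B` in `U` overlap only along `C`, where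
the pushout has already identified them. -/
lemma pushout_desc_injective (sq : IsPushout g h i j) {U : Pointed.{u}} {f : A ⟶ U} {t : B ⟶ U}
    {d : P ⟶ U} (hi : i ≫ d = f) (hj : j ≫ d = t) (hf : Function.Injective f.toFun)
    (ht : Function.Injective t.toFun)
    (hft : ∀ a b, f.toFun a = t.toFun b → ∃ c, g.toFun c = a ∧ h.toFun c = b) :
    Function.Injective d.toFun := by
  subst hi hj
  have w : ∀ c, i.toFun (g.toFun c) = j.toFun (h.toFun c) :=
    fun c => congrFun (congrArg Pointed.Hom.toFun sq.w) c
  intro z z' e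
  rcases pushout_cases sq z with ⟨a, rfl⟩ | ⟨b, rfl⟩ <;>
    rcases pushout_cases sq z' with ⟨a', rfl⟩ | ⟨b', rfl⟩
  · rw [hf e]
  · obtain ⟨c, rfl, rfl⟩ := hft a b' e
    exact w c
  · obtain ⟨c, rfl, rfl⟩ := hft a' b e.symm
    exact (w c).symm
  · rw [ht e]

end Pushout

end Pointed

/-! ### Monomorphisms, isomorphisms and pushouts of pointed simplicial sets, degree by degree. -/

namespace PSSet

/-- For the direct implication: forgetting base points is right adjoint to adding them, also after
whiskering, so it preserves monomorphisms; in presheaves of sets these are the degreewise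
injections. -/
lemma mono_iff_injective {A B : PSSet.{u}} (f : A ⟶ B) :
    Mono f ↔ ∀ k, Function.Injective (f.app k).toFun := by
  constructor
  · intro hf k
    let R := (Functor.whiskeringRight SimplexCategoryᵒᵖ _ _).obj (forget Pointed.{u})
    have adj := Adjunction.whiskerRight SimplexCategoryᵒᵖ typeToPointedForgetAdjunction.{u}
    have := Functor.preservesMonomorphisms_of_adjunction adj
    have h : Mono (R.map f) := R.map_mono f
    rw [NatTrans.mono_iff_mono_app] at h
    exact (CategoryTheory.mono_iff_injective _).mp (h k)
  · intro hf
    have := fun k => Pointed.mono_of_injective _ (hf k)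
    exact NatTrans.mono_of_mono_app f

lemma isIso_iff_bijective {A B : PSSet.{u}} (f : A ⟶ B) :
    IsIso f ↔ ∀ k, Function.Bijective (f.app k).toFun := by
  rw [NatTrans.isIso_iff_isIso_app]
  simp only [Pointed.isIso_iff_bijective]

lemma isPushout_app {C A B : PSSet.{u}} (g : C ⟶ A) (h : C ⟶ B) (k : SimplexCategoryᵒᵖ) :
    IsPushout (g.app k) (h.app k) ((pushout.inl g h).app k) ((pushout.inr g h).app k) :=
  (IsPushout.of_hasPushout g h).map ((evaluation _ _).obj k)

end PSSet

/-! ### Flat cofibrations in terms of elements. -/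

namespace SymSpectrum

variable {X Y Z : SymSpectrum.{u}} {k : SimplexCategoryᵒᵖ}

/-- The map of `k`-simplices in level `m` induced by a morphism of symmetric spectra. -/
def mapAt (f : X ⟶ Y) (m : ℕ) (k : SimplexCategoryᵒᵖ) :
    (X.level m).obj k → (Y.level m).obj k :=
  ((f.app m).app k).toFun

/-- The map of `k`-simplices of latching objects induced by a morphism. -/
def latchMapAt (f : X ⟶ Y) (m : ℕ) (k : SimplexCategoryᵒᵖ) :
    (latch X m).obj k → (latch Y m).obj k :=
  ((latchMap f m).app k).toFun

/-- The latching map `L_m X ⟶ X(m)` on `k`-simplices. -/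
def nuAt (X : SymSpectrum.{u}) (m : ℕ) (k : SimplexCategoryᵒᵖ) :
    (latch X m).obj k → (X.level m).obj k :=
  ((latchToLevel X m).app k).toFun

lemma mapAt_comp (f : X ⟶ Y) (g : Y ⟶ Z) (m : ℕ) (x : (X.level m).obj k) :
    mapAt (f ≫ g) m k x = mapAt g m k (mapAt f m k x) := rfl

lemma mapAt_point (f : X ⟶ Y) (m : ℕ) :
    mapAt f m k ((X.level m).obj k).point = ((Y.level m).obj k).point :=
  Pointed.Hom.map_point _

lemma latchMapAt_smashMk (f : X ⟶ Y) {p r m : ℕ} (e : Fin p ⊕ Fin r ≃ Fin m)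
    (s : (sphereBar.{u}.level p).obj k) (x : (X.level r).obj k) :
    latchMapAt f m k (smashMk e s x) = smashMk (X := sphereBar) e s (mapAt f r k x) := rfl

lemma nuAt_point (X : SymSpectrum.{u}) (m : ℕ) :
    nuAt X m k ((latch X m).obj k).point = ((X.level m).obj k).point :=
  Pointed.Hom.map_point _

lemma latchMapAt_id (m : ℕ) (z : (latch X m).obj k) : latchMapAt (𝟙 X) m k z = z := by
  induction z using smash_induction with
  | h p r e s x => rfl
  | h₀ => rfl

lemma latchMapAt_comp (f : X ⟶ Y) (g : Y ⟶ Z) (m : ℕ) (z : (latch X m).obj k) :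
    latchMapAt (f ≫ g) m k z = latchMapAt g m k (latchMapAt f m k z) := by
  induction z using smash_induction with
  | h p r e s x => rfl
  | h₀ => rfl

lemma mapAt_nuAt (f : X ⟶ Y) (m : ℕ) (z : (latch X m).obj k) :
    mapAt f m k (nuAt X m k z) = nuAt Y m k (latchMapAt f m k z) :=
  congrFun (congrArg Pointed.Hom.toFun (NatTrans.congr_app (latchToLevel_naturality f m) k)) z

lemma isPushout_latchComparison (f : X ⟶ Y) (m : ℕ) (k : SimplexCategoryᵒᵖ) :
    IsPushout ((latchToLevel X m).app k) ((latchMap f m).app k)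
      ((pushout.inl (latchToLevel X m) (latchMap f m)).app k)
      ((pushout.inr (latchToLevel X m) (latchMap f m)).app k) :=
  PSSet.isPushout_app _ _ _

lemma inl_latchComparison (f : X ⟶ Y) (m : ℕ) (k : SimplexCategoryᵒᵖ) :
    (pushout.inl (latchToLevel X m) (latchMap f m)).app k ≫ (latchComparison f m).app k =
      (f.app m).app k :=
  NatTrans.congr_app (pushout.inl_desc _ _ _) k

lemma inr_latchComparison (f : X ⟶ Y) (m : ℕ) (k : SimplexCategoryᵒᵖ) :
    (pushout.inr (latchToLevel X m) (latchMap f m)).app k ≫ (latchComparison f m).app k =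
      (latchToLevel Y m).app k :=
  NatTrans.congr_app (pushout.inr_desc _ _ _) k

/-- A morphism is a flat cofibration if it is injective, the latching maps of its target are
injective, and it reflects the images of the latching maps. -/
lemma flatCofibration_of_injective (f : X ⟶ Y)
    (hf : ∀ m k, Function.Injective (mapAt f m k))
    (hY : ∀ m k, Function.Injective (nuAt Y m k))
    (hfY : ∀ m k x, mapAt f m k x ∈ Set.range (nuAt Y m k) → x ∈ Set.range (nuAt X m k)) :
    flatCofibration f := by
  intro m
  rw [PSSet.mono_iff_injective]
  intro k
  refine Pointed.pushout_desc_injective (isPushout_latchComparison f m k)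
    (inl_latchComparison f m k) (inr_latchComparison f m k) (hf m k) (hY m k) ?_
  intro x z hxz
  -- Reflection provides `z'` over `x`; naturality and injectivity of the latching map of `Y` force
  -- its image in `L_m Y` to be `z`.
  obtain ⟨z', rfl⟩ := hfY m k x ⟨z, hxz.symm⟩
  exact ⟨z', rfl, hY m k ((mapAt_nuAt f m z').symm.trans hxz)⟩

namespace flatCofibration

variable {f : X ⟶ Y} (hf : flatCofibration f)
include hf

lemma comparison_injective (m : ℕ) (k : SimplexCategoryᵒᵖ) :
    Function.Injective ((latchComparison f m).app k).toFun :=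
  (PSSet.mono_iff_injective _).mp (hf m) k

/-- The comparison map is injective, so an equality in `Y(m)` already holds in the pushout, where
`X(m)` and `L_m Y` meet only in the image of `L_m X`. -/
lemma mem_range_nuAt {m : ℕ} {x : (X.level m).obj k}
    (hx : mapAt f m k x ∈ Set.range (nuAt Y m k)) : x ∈ Set.range (nuAt X m k) := by
  obtain ⟨z, hz⟩ := hx
  refine Pointed.pushout_inl_eq_inr (isPushout_latchComparison f m k) (b := z)
    (hf.comparison_injective m k ?_)
  have h₁ := congrFun (congrArg Pointed.Hom.toFun (inl_latchComparison f m k)) x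
  have h₂ := congrFun (congrArg Pointed.Hom.toFun (inr_latchComparison f m k)) z
  exact h₁.trans (hz.symm.trans h₂.symm)

/-- Elements of `L_m Y` identified in `Y(m)` are identified in the pushout, hence come from `L_m X`
unless equal. This holds without flatness of `X` or `Y`, which is what allows flatness to be deduced
from it later. -/
lemma eq_or_mem_range_latchMapAt {m : ℕ} {z z' : (latch Y m).obj k}
    (h : nuAt Y m k z = nuAt Y m k z') :
    z = z' ∨ (z ∈ Set.range (latchMapAt f m k) ∧ z' ∈ Set.range (latchMapAt f m k)) := by
  refine Pointed.pushout_inr_eq_inr (isPushout_latchComparison f m k)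
    (hf.comparison_injective m k ?_)
  have h₂ := congrFun (congrArg Pointed.Hom.toFun (inr_latchComparison f m k))
  exact (h₂ z).trans (h.trans (h₂ z').symm)

/-- The map `f` factors as a cobase change of `L_m f` followed by the injective comparison map. -/
lemma mapAt_injective_of_latchMapAt {m : ℕ} (h : Function.Injective (latchMapAt f m k)) :
    Function.Injective (mapAt f m k) := by
  have h₁ := Pointed.pushout_inl_injective (isPushout_latchComparison f m k) h
  have h₂ := congrArg Pointed.Hom.toFun (inl_latchComparison f m k)
  have h₃ := (hf.comparison_injective m k).comp h₁
  intro x x' e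
  exact h₃ ((congrFun h₂ x).trans (e.trans (congrFun h₂ x').symm))

end flatCofibration

/-! ### Flat cofibrations with flat target are injective. -/

/-- This makes induction on the level possible: a class `s ∧ x` in `L_m X` with `x` in level `m` has
`s` in level `0`, so it is the base point, and only levels below `m` contribute. -/
lemma sphereBar_zero (s : (sphereBar.{u}.level 0).obj k) :
    s = ((sphereBar.{u}.level 0).obj k).point := by
  induction s using sphere_induction with
  | h h s => exact absurd h (by omega)
  | h₀ => rfl

/-- The decomposition of `Fin (r + 1)` into its last element and the other ones. -/
def lastSumEquiv (r : ℕ) : Fin 1 ⊕ Fin r ≃ Fin (r + 1) :=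
  (Equiv.sumComm _ _).trans finSumFinEquiv

/-- The element `t ∧ x` of `L_{r + 1} X`. -/
def latchSig {r : ℕ} (x : (X.level r).obj k) (t : PSSet.S1.{u}.obj k) :
    (latch X (r + 1)).obj k :=
  smashMk (X := sphereBar) (lastSumEquiv r) (sphereMk (le_refl 1) fun _ => t) x

/-- The bijection attached to `lastSumEquiv` is the identity, so no permutation intervenes.
Consequently every value of a structure map lies in the image of a latching map. -/
lemma nuAt_latchSig {r : ℕ} (x : (X.level r).obj k) (t : PSSet.S1.{u}.obj k) :
    nuAt X (r + 1) k (latchSig x t) = X.sig x t := by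
  have h : flipEquiv (lastSumEquiv r) = 1 := by
    ext i
    simp [flipEquiv, lastSumEquiv]
  change X.mapE (flipEquiv (lastSumEquiv r)) (X.sig x t) = _
  rw [h]
  exact X.perm_one _

namespace flatCofibration

variable {f : X ⟶ Y} (hf : flatCofibration f)

/-- The property of a function `L_m Y ⟶ L_m X` of being the retraction of `L_m f` which collapses
all the elements which do not come from `X`. -/
def IsLatchRetraction (f : X ⟶ Y) (m : ℕ) (k : SimplexCategoryᵒᵖ)
    (ρ : (latch Y m).obj k ⟶ (latch X m).obj k) : Prop :=
  (∀ {p r : ℕ} (e : Fin p ⊕ Fin r ≃ Fin m) (s : (sphereBar.{u}.level p).obj k)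
    (x : (X.level r).obj k),
      ρ.toFun (smashMk e s (mapAt f r k x)) = smashMk (X := sphereBar) e s x) ∧
  (∀ {p r : ℕ} (e : Fin p ⊕ Fin r ≃ Fin m) (s : (sphereBar.{u}.level p).obj k)
    (y : (Y.level r).obj k), y ∉ Set.range (mapAt f r k) →
      ρ.toFun (smashMk e s y) = ((latch X m).obj k).point)

lemma IsLatchRetraction.leftInverse {m : ℕ} {ρ : (latch Y m).obj k ⟶ (latch X m).obj k}
    (hρ : IsLatchRetraction f m k ρ) :
    Function.LeftInverse ρ.toFun (latchMapAt f m k) := by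
  intro z
  induction z using smash_induction with
  | h p r e s x => exact hρ.1 e s x
  | h₀ => exact ρ.map_point

include hf

open Classical in
-- The retraction sends `s ∧ f(x)` to `s ∧ x` and every other `s ∧ y` to the base point. The image
-- of `f` is stable under permutations, so the only delicate point is the balancing relation when
-- `y` is not in the image of `f` but `σ(y, t)` is; the retraction in a lower level shows that `σ(y,
-- t)` is then the base point.
lemma exists_latchRetraction (hY : ∀ m, Function.Injective (nuAt Y m k)) (m : ℕ)
    (hinj : ∀ r < m, Function.Injective (mapAt f r k))
    (hret : ∀ r < m, ∃ ρ, IsLatchRetraction f r k ρ) : ∃ ρ, IsLatchRetraction f m k ρ := by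
  let b : ∀ {p r : ℕ}, (Fin p ⊕ Fin r ≃ Fin m) → (sphereBar.{u}.level p).obj k →
      (Y.level r).obj k → (latch X m).obj k := fun e s y =>
    if h : ∃ x, mapAt f _ k x = y then smashMk e s h.choose else ((latch X m).obj k).point
  have b_range : ∀ {p r : ℕ} (e : Fin p ⊕ Fin r ≃ Fin m) (s : (sphereBar.{u}.level p).obj k)
      (x : (X.level r).obj k), b e s (mapAt f r k x) = smashMk (X := sphereBar) e s x := by
    intro p r e s x
    have h : ∃ x', mapAt f r k x' = mapAt f r k x := ⟨x, rfl⟩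
    refine (dif_pos h).trans ?_
    have hpr : p + r = m := by simpa using Fintype.card_congr e
    rcases Nat.eq_zero_or_pos p with rfl | hp
    -- For `p = 0` one has `r = m`, where injectivity of `f` is not yet known, but both classes
    -- vanish.
    · rw [sphereBar_zero s, smashMk_left, smashMk_left]
    · rw [hinj r (by omega) h.choose_spec]
  have b_not : ∀ {p r : ℕ} (e : Fin p ⊕ Fin r ≃ Fin m) (s : (sphereBar.{u}.level p).obj k)
      (y : (Y.level r).obj k), y ∉ Set.range (mapAt f r k) →
        b e s y = ((latch X m).obj k).point := fun e s y hy => dif_neg hy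
  have b_left : ∀ {p r : ℕ} (e : Fin p ⊕ Fin r ≃ Fin m) (y : (Y.level r).obj k),
      b e ((sphereBar.{u}.level p).obj k).point y = ((latch X m).obj k).point := by
    intro p r e y
    by_cases hy : y ∈ Set.range (mapAt f r k)
    · obtain ⟨x, rfl⟩ := hy
      rw [b_range, smashMk_left]
      rfl
    · exact b_not e _ y hy
  have b_right : ∀ {p r : ℕ} (e : Fin p ⊕ Fin r ≃ Fin m) (s : (sphereBar.{u}.level p).obj k),
      b e s ((Y.level r).obj k).point = ((latch X m).obj k).point := by
    intro p r e s
    rw [← mapAt_point f r, b_range, smashMk_right]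
    rfl
  refine ⟨smashLift (X := sphereBar) (Y := Y) (A := (latch X m).obj k) b b_left b_right ?_ ?_,
    fun e s x => b_range e s x, fun e s y hy => b_not e s y hy⟩
  · intro p r e α β s y
    by_cases hy : y ∈ Set.range (mapAt f r k)
    · obtain ⟨x, rfl⟩ := hy
      have h : Y.perm β (mapAt f r k x) = mapAt f r k (X.perm β x) := (Hom.app_perm f β x).symm
      rw [h, b_range, b_range, smashMk_perm]
    · have hy' : Y.perm β y ∉ Set.range (mapAt f r k) := by
        rintro ⟨x, hx⟩
        refine hy ⟨X.perm β⁻¹ x, ?_⟩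
        have h : mapAt f r k (X.perm β⁻¹ x) = Y.perm β⁻¹ (mapAt f r k x) := Hom.app_perm f β⁻¹ x
        rw [h, hx, ← perm_mul, inv_mul_cancel, perm_one]
      rw [b_not _ _ _ hy, b_not _ _ _ hy']
  · intro p r e s t y
    by_cases hy : y ∈ Set.range (mapAt f r k)
    · obtain ⟨x, rfl⟩ := hy
      have h : Y.sig (mapAt f r k x) t = mapAt f (r + 1) k (X.sig x t) := (Hom.app_sig f x t).symm
      rw [h, b_range, b_range, smashMk_sig]
    · rw [b_not _ _ _ hy]
      -- Here `t ∧ y` in `L_{r+1} Y` maps to `σ(y, t) = f(x')`. By reflection `x'` is the image of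
      -- some `z` in `L_{r+1} X`, and `z` maps to `t ∧ y` since the latching map of `Y` is
      -- injective. The retraction recovers `z` but collapses `t ∧ y`, so `z` and `x'` are base
      -- points. For `p ≥ 1` the level `r + 1` is below `m = p + 1 + r`; for `p = 0` the factor `s`
      -- is trivial.
      by_cases hy' : Y.sig y t ∈ Set.range (mapAt f (r + 1) k)
      · obtain ⟨x', hx'⟩ := hy'
        have hpr : p + 1 + r = m := by simpa using Fintype.card_congr e
        rcases Nat.eq_zero_or_pos p with rfl | hp
        · rw [sphereBar_zero s, b_left]
        · obtain ⟨ρ, hρ⟩ := hret (r + 1) (by omega)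
          have h₁ := nuAt_latchSig y t
          obtain ⟨z, rfl⟩ := hf.mem_range_nuAt (x := x') ⟨_, h₁.trans hx'.symm⟩
          have h₂ : latchMapAt f (r + 1) k z = latchSig y t :=
            hY _ ((mapAt_nuAt f _ z).symm.trans (hx'.trans h₁.symm))
          have h₃ : z = ((latch X (r + 1)).obj k).point := by
            rw [← hρ.leftInverse z, h₂]
            exact hρ.2 _ _ _ hy
          rw [← hx', h₃, nuAt_point, b_range, smashMk_right]
          rfl
      · rw [b_not _ _ _ hy']

/-- A flat cofibration with a flat target is injective. -/
lemma mapAt_injective (hY : ∀ m, Function.Injective (nuAt Y m k)) (m : ℕ) :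
    Function.Injective (mapAt f m k) := by
  -- The retraction in level `m` needs both properties below `m`, and it yields injectivity in level
  -- `m`, so the two are carried together through the induction.
  suffices h : Function.Injective (mapAt f m k) ∧ ∃ ρ, IsLatchRetraction f m k ρ from h.1
  induction m using Nat.strong_induction_on with
  | _ m ih =>
    obtain ⟨ρ, hρ⟩ := hf.exists_latchRetraction hY m (fun r hr => (ih r hr).1)
      (fun r hr => (ih r hr).2)
    exact ⟨hf.mapAt_injective_of_latchMapAt hρ.leftInverse.injective, ρ, hρ⟩

end flatCofibration

end SymSpectrum

/-! ### Degenerate simplices of pointed simplicial sets. -/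

namespace PSSet

variable (S : PSSet.{u})

/-- The degeneracy operator `s_i` on simplices. -/
def degen {n : ℕ} (i : Fin (n + 1)) :
    S.obj (op (SimplexCategory.mk n)) → S.obj (op (SimplexCategory.mk (n + 1))) :=
  (SimplicialObject.σ S i).toFun

/-- The face operator `d_i` on simplices. -/
def face {n : ℕ} (i : Fin (n + 2)) :
    S.obj (op (SimplexCategory.mk (n + 1))) → S.obj (op (SimplexCategory.mk n)) :=
  (SimplicialObject.δ S i).toFun

lemma face_castSucc_degen {n : ℕ} (i : Fin (n + 1)) (x : S.obj (op (SimplexCategory.mk n))) :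
    S.face i.castSucc (S.degen i x) = x :=
  congrFun (congrArg Pointed.Hom.toFun (SimplicialObject.δ_comp_σ_self S (i := i))) x

lemma face_succ_degen {n : ℕ} (i : Fin (n + 1)) (x : S.obj (op (SimplexCategory.mk n))) :
    S.face i.succ (S.degen i x) = x :=
  congrFun (congrArg Pointed.Hom.toFun (SimplicialObject.δ_comp_σ_succ S (i := i))) x

lemma degen_injective {n : ℕ} (i : Fin (n + 1)) : Function.Injective (S.degen i) :=
  Function.LeftInverse.injective (S.face_castSucc_degen i)

lemma degen_degen {n : ℕ} {i j : Fin (n + 1)} (h : i ≤ j)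
    (x : S.obj (op (SimplexCategory.mk n))) :
    S.degen i.castSucc (S.degen j x) = S.degen j.succ (S.degen i x) :=
  congrFun (congrArg Pointed.Hom.toFun (SimplicialObject.σ_comp_σ S h)) x

lemma face_degen_of_gt {n : ℕ} {i : Fin (n + 2)} {j : Fin (n + 1)} (h : j.castSucc < i)
    (x : S.obj (op (SimplexCategory.mk (n + 1)))) :
    S.face i.succ (S.degen j.castSucc x) = S.degen j (S.face i x) :=
  congrFun (congrArg Pointed.Hom.toFun (SimplicialObject.δ_comp_σ_of_gt S h)) x

variable {S} in
/-- If `s_i x = s_{j + 1} y` with `i ≤ j`, then `x = s_j w` and `y = s_i w` for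
`w = d_{j + 1} x`. -/
lemma eq_degen_of_degen_eq_degen {n : ℕ} {i j : Fin (n + 1)} (h : i ≤ j)
    {x y : S.obj (op (SimplexCategory.mk (n + 1)))}
    (e : S.degen i.castSucc x = S.degen j.succ y) :
    x = S.degen j (S.face j.succ x) ∧ y = S.degen i (S.face j.succ x) := by
  -- Apply `d_{j+2}` to `e`: it cancels `s_{j+1}` on the right and passes `s_i` on the left,
  -- becoming `d_{j+1}`.
  have hy : y = S.degen i (S.face j.succ x) := by
    rw [← face_degen_of_gt S (Fin.castSucc_lt_succ_iff.mpr h), e,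
      face_succ_degen]
  refine ⟨?_, hy⟩
  -- With `w = d_{j+1} x`, one has `s_i x = s_{j+1} y = s_{j+1} s_i w = s_i s_j w`, and `s_i` can be
  -- cancelled.
  apply S.degen_injective i.castSucc
  rw [e, degen_degen S h, ← hy]

variable {S} {T : PSSet.{u}} (g : S ⟶ T)

lemma app_degen {n : ℕ} (i : Fin (n + 1)) (x : S.obj (op (SimplexCategory.mk n))) :
    (g.app _).toFun (S.degen i x) = T.degen i ((g.app _).toFun x) :=
  naturality_apply g _ x

lemma app_face {n : ℕ} (i : Fin (n + 2)) (x : S.obj (op (SimplexCategory.mk (n + 1)))) :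
    (g.app _).toFun (S.face i x) = T.face i ((g.app _).toFun x) :=
  naturality_apply g _ x

/-- An injective map reflects degenerate simplices. -/
lemma eq_degen_of_app_eq_degen {n : ℕ}
    (hg : Function.Injective (g.app (op (SimplexCategory.mk (n + 1)))).toFun) {i : Fin (n + 1)}
    {x : S.obj (op (SimplexCategory.mk (n + 1)))} {y : T.obj (op (SimplexCategory.mk n))}
    (e : (g.app _).toFun x = T.degen i y) :
    x = S.degen i (S.face i.castSucc x) ∧ (g.app _).toFun (S.face i.castSucc x) = y := by
  -- Applying `d_i` to `e` cancels `s_i`.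
  have h : (g.app _).toFun (S.face i.castSucc x) = y := by
    rw [app_face, e, face_castSucc_degen]
  exact ⟨hg (by rw [app_degen, h, e]), h⟩

/-- A map is injective if only degenerate simplices are identified by it. -/
lemma app_injective_of_degenerate
    (h₀ : Function.Injective (g.app (op (SimplexCategory.mk 0))).toFun)
    (h : ∀ (n : ℕ) (x y : S.obj (op (SimplexCategory.mk (n + 1)))),
      (g.app _).toFun x = (g.app _).toFun y →
      x = y ∨ ((∃ i x', S.degen i x' = x) ∧ ∃ j y', S.degen j y' = y)) (n : ℕ) :
    Function.Injective (g.app (op (SimplexCategory.mk n))).toFun := by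
  induction n with
  | zero => exact h₀
  | succ n ih =>
    intro x y e
    rcases h n x y e with rfl | ⟨⟨i, x', rfl⟩, j, y', rfl⟩
    · rfl
    -- For different indices, the equality in `T` makes `g x'` and `g y'` degeneracies of one
    -- simplex, a face of `g x'` and hence the image of a face of `x'`. The induction hypothesis
    -- lifts both equations to `S`, where the two sides become the same double degeneracy.
    have key : ∀ (i j : Fin (n + 1)) (x' y' : S.obj (op (SimplexCategory.mk n))), i < j →
        (g.app _).toFun (S.degen i x') = (g.app _).toFun (S.degen j y') →
        S.degen i x' = S.degen j y' := by
      intro i j x' y' hij e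
      rw [app_degen, app_degen] at e
      obtain _ | n := n
      · omega
      obtain ⟨i, rfl⟩ := Fin.exists_castSucc_eq.mpr (Fin.ne_last_of_lt hij)
      obtain ⟨j, rfl⟩ := Fin.exists_succ_eq.mpr (Fin.ne_zero_of_lt hij)
      have hij' : i ≤ j := Fin.castSucc_lt_succ_iff.mp hij
      obtain ⟨hx, hy⟩ := eq_degen_of_degen_eq_degen hij' e
      rw [← app_face, ← app_degen] at hx hy
      rw [ih hx, ih hy, ← degen_degen S hij']
    rcases lt_trichotomy i j with hij | rfl | hij
    · exact key i j x' y' hij e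
    · rw [app_degen, app_degen] at e
      rw [ih (T.degen_injective i e)]
    · exact (key j i y' x' hij e.symm).symm

end PSSet

/-! ### Degeneracies as maps into the Reedy latching object. -/

namespace Reedy

variable {C : Type*} [Category C] [HasZeroObject C] [HasFiniteColimits C]

/-- The map from `X_n` to the latching object `L_{n + 1} X` corresponding to the degeneracy
`s_i`. -/
noncomputable def degenToLatch (X : SimplicialObject C) :
    (n : ℕ) → Fin (n + 1) → (simplices X n ⟶ latch X (n + 1))
  | 0, _ => 𝟙 _
  | n + 1, i => Sigma.ι (fun _ : Fin (n + 2) => simplices X (n + 1)) i ≫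
      coequalizer.π (latchFst X n) (latchSnd X n)

lemma degenToLatch_comp_latchToSimplices (X : SimplicialObject C) (n : ℕ) (i : Fin (n + 1)) :
    degenToLatch X n i ≫ latchToSimplices X (n + 1) = X.σ i := by
  match n with
  | 0 =>
    obtain rfl : i = 0 := Fin.fin_one_eq_zero i
    exact Category.id_comp _
  | n + 1 =>
    change (Sigma.ι _ i ≫ coequalizer.π _ _) ≫ latchToSimplicesAux X n = _
    rw [Category.assoc, latchToSimplicesAux, coequalizer.π_desc, Sigma.ι_desc]

lemma degenToLatch_comp_latchMap {X Y : SimplicialObject C} (f : X ⟶ Y) (n : ℕ)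
    (i : Fin (n + 1)) :
    degenToLatch X n i ≫ latchMap f (n + 1) = f.app _ ≫ degenToLatch Y n i := by
  match n with
  | 0 => exact (Category.id_comp _).trans (Category.comp_id _).symm
  | n + 1 =>
    change (Sigma.ι _ i ≫ coequalizer.π _ _) ≫ latchMapAux f n = _
    rw [Category.assoc, latchMapAux, coequalizer.π_desc, Sigma.ι_map_assoc]
    rfl

/-- This is the coequalizer relation on the summand `(i, j)` of `Pairs n`, which encodes the strict
pair `i < j + 1`. -/
lemma σ_comp_degenToLatch (X : SimplicialObject C) {n : ℕ} {i j : Fin (n + 1)} (h : i ≤ j) :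
    X.σ i ≫ degenToLatch X (n + 1) j.succ = X.σ j ≫ degenToLatch X (n + 1) i.castSucc := by
  have := congrArg (fun g => Sigma.ι (fun _ : Pairs n => simplices X n) ⟨(i, j), h⟩ ≫ g)
    (coequalizer.condition (latchFst X n) (latchSnd X n))
  simp only [latchFst, latchSnd, Sigma.ι_desc_assoc, Category.assoc] at this
  exact this

end Reedy

/-! ### Elements of colimits of symmetric spectra. -/

namespace SymSpectrum

/-- The elements of a colimit of symmetric spectra come from the diagram. -/
lemma exists_of_isColimit {J : Type} [SmallCategory J] {F : J ⥤ SymSpectrum.{u}} {c : Cocone F}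
    (hc : IsColimit c) {m : ℕ} {k : SimplexCategoryᵒᵖ} (z : (c.pt.level m).obj k) :
    (∃ j x, mapAt (c.ι.app j) m k x = z) ∨ z = ((c.pt.level m).obj k).point := by
  let φ := (colimCoconeIsColimit F).coconePointUniqueUpToIso hc
  have hφ : mapAt φ.hom m k (mapAt φ.inv m k z) = z :=
    congrArg (fun g => mapAt g m k z) φ.inv_hom_id
  rw [← hφ]
  induction mapAt φ.inv m k z using colim_induction with
  | h j x =>
    refine Or.inl ⟨j, x, ?_⟩
    exact congrArg (fun g => mapAt g m k x)
      ((colimCoconeIsColimit F).comp_coconePointUniqueUpToIso_hom hc j).symm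
  | h₀ => exact Or.inr (mapAt_point φ.hom m)

/-- Representatives, together with the defining equation of the pushout, suffice below: injectivity
of maps out of it is tested on pairs of representatives. -/
lemma exists_of_pushout {A B C : SymSpectrum.{u}} (g : C ⟶ A) (h : C ⟶ B) {m : ℕ}
    {k : SimplexCategoryᵒᵖ} (z : ((pushout g h).level m).obj k) :
    (∃ a, mapAt (pushout.inl g h) m k a = z) ∨ ∃ b, mapAt (pushout.inr g h) m k b = z := by
  rcases exists_of_isColimit (colimit.isColimit (span g h)) z with ⟨_ | _ | _, x, hx⟩ | hz
  · refine Or.inl ⟨mapAt g m k x, ?_⟩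
    rw [← hx]
    exact congrArg (fun q => mapAt q m k x)
      (colimit.w (span g h) WalkingSpan.Hom.fst)
  · exact Or.inl ⟨x, hx⟩
  · exact Or.inr ⟨x, hx⟩
  · exact Or.inl ⟨_, (mapAt_point _ m).trans hz.symm⟩

lemma exists_of_coequalizer {A B : SymSpectrum.{u}} (g h : A ⟶ B) {m : ℕ}
    {k : SimplexCategoryᵒᵖ} (z : ((coequalizer g h).level m).obj k) :
    ∃ b, mapAt (coequalizer.π g h) m k b = z := by
  rcases exists_of_isColimit (colimit.isColimit (parallelPair g h)) z with ⟨_ | _, x, hx⟩ | hz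
  · refine ⟨mapAt g m k x, ?_⟩
    rw [← hx]
    exact congrArg (fun q => mapAt q m k x)
      (colimit.w (parallelPair g h) WalkingParallelPairHom.left)
  · exact ⟨x, hx⟩
  · exact ⟨_, (mapAt_point _ m).trans hz.symm⟩

lemma exists_of_sigma {ι : Type} (B : ι → SymSpectrum.{u}) {m : ℕ}
    {k : SimplexCategoryᵒᵖ} (z : ((∐ B).level m).obj k) :
    (∃ i b, mapAt (Sigma.ι B i) m k b = z) ∨ z = (((∐ B).level m).obj k).point := by
  rcases exists_of_isColimit (colimit.isColimit (Discrete.functor B)) z with ⟨⟨i⟩, x, hx⟩ | hz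
  · exact Or.inl ⟨i, x, hx⟩
  · exact Or.inr hz

/-- The identity of a zero object factors through `pointSpectrum`, whose only elements are base
points. -/
lemma eq_point_of_isZero {A : SymSpectrum.{u}} (hA : IsZero A) {m : ℕ} {k : SimplexCategoryᵒᵖ}
    (x : (A.level m).obj k) : x = ((A.level m).obj k).point := by
  have h₁ : mapAt (hA.to_ pointSpectrum ≫ hA.from_ pointSpectrum) m k x = x :=
    congrArg (fun q => mapAt q m k x) (hA.eq_of_src (hA.to_ _ ≫ hA.from_ _) (𝟙 A))
  rw [← h₁]
  exact mapAt_point (hA.from_ pointSpectrum) m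

/-- The pointed simplicial set `n ↦ X_n(m)_k`. -/
def levelAt (X : SimplicialObject SymSpectrum.{u}) (m : ℕ) (k : SimplexCategoryᵒᵖ) : PSSet.{u} where
  obj n := ((X.obj n).level m).obj k
  map φ := ((X.map φ).app m).app k
  map_id n := by rw [X.map_id]; rfl
  map_comp φ ψ := by rw [X.map_comp]; rfl

/-- The map `n ↦ (f_n(m)_k : X_n(m)_k ⟶ Y_n(m)_k)`. -/
def levelAtMap {X Y : SimplicialObject SymSpectrum.{u}} (f : X ⟶ Y) (m : ℕ)
    (k : SimplexCategoryᵒᵖ) : levelAt X m k ⟶ levelAt Y m k where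
  app n := ((f.app n).app m).app k
  naturality _ _ φ := congrArg (fun g => NatTrans.app (Hom.app g m) k) (f.naturality φ)

/-- The pointed simplicial set `n ↦ (L_m X_n)_k`. -/
def latchAt (X : SimplicialObject SymSpectrum.{u}) (m : ℕ) (k : SimplexCategoryᵒᵖ) : PSSet.{u} where
  obj n := (latch (X.obj n) m).obj k
  map φ := (latchMap (X.map φ) m).app k
  map_id n := by
    apply Pointed.Hom.ext
    funext z
    rw [X.map_id]
    exact latchMapAt_id m z
  map_comp φ ψ := by
    apply Pointed.Hom.ext
    funext z
    rw [X.map_comp]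
    exact latchMapAt_comp _ _ m z

/-- The map `n ↦ ((L_m X_n)_k ⟶ X_n(m)_k)`. -/
def latchAtToLevelAt (X : SimplicialObject SymSpectrum.{u}) (m : ℕ) (k : SimplexCategoryᵒᵖ) :
    latchAt X m k ⟶ levelAt X m k where
  app n := (latchToLevel (X.obj n) m).app k
  naturality n l φ := by
    apply Pointed.Hom.ext
    funext z
    exact (mapAt_nuAt (X.map φ) m z).symm

/-! ### Reedy latching maps and relative latching maps on elements. -/

section ReedyLatching

open Reedy

variable {X Y : SimplicialObject SymSpectrum.{u}} {m : ℕ} {k : SimplexCategoryᵒᵖ}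

lemma latch_zero_eq_point (z : ((Reedy.latch X 0).level m).obj k) :
    z = (((Reedy.latch X 0).level m).obj k).point :=
  eq_point_of_isZero (isZero_zero _) z

lemma exists_degenToLatch {n : ℕ} (z : ((Reedy.latch X (n + 1)).level m).obj k) :
    ∃ i x, mapAt (degenToLatch X n i) m k x = z := by
  match n with
  | 0 => exact ⟨0, z, rfl⟩
  | n + 1 =>
    obtain ⟨z, rfl⟩ := exists_of_coequalizer (latchFst X n) (latchSnd X n) z
    rcases exists_of_sigma _ z with ⟨i, x, rfl⟩ | rfl
    · exact ⟨i, x, rfl⟩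
    -- The base point of the coproduct need not come from a chosen summand; the base point of
    -- summand `0` represents it.
    · refine ⟨0, _, (mapAt_point (degenToLatch X (n + 1) 0) m).trans ?_⟩
      exact (mapAt_point (coequalizer.π (latchFst X n) (latchSnd X n)) m).symm

lemma mapAt_latchToSimplices_degenToLatch {n : ℕ} (i : Fin (n + 1))
    (x : ((simplices X n).level m).obj k) :
    mapAt (latchToSimplices X (n + 1)) m k (mapAt (degenToLatch X n i) m k x) =
      (levelAt X m k).degen i x :=
  congrArg (fun q => mapAt q m k x) (degenToLatch_comp_latchToSimplices X n i)

lemma mapAt_latchMap_degenToLatch (f : X ⟶ Y) {n : ℕ} (i : Fin (n + 1))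
    (x : ((simplices X n).level m).obj k) :
    mapAt (Reedy.latchMap f (n + 1)) m k (mapAt (degenToLatch X n i) m k x) =
      mapAt (degenToLatch Y n i) m k (mapAt (f.app _) m k x) :=
  congrArg (fun q => mapAt q m k x) (degenToLatch_comp_latchMap f n i)

/-- Writing `j = j' + 1`, the equality forces `x = s_{j'} w` and `y = s_i w` for a common `w`, and
the coequalizer identifies exactly these two representatives. -/
lemma mapAt_degenToLatch_eq {n : ℕ} {i j : Fin (n + 1)} (h : i < j)
    {x y : ((simplices X n).level m).obj k}
    (e : (levelAt X m k).degen i x = (levelAt X m k).degen j y) :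
    mapAt (degenToLatch X n i) m k x = mapAt (degenToLatch X n j) m k y := by
  obtain _ | n := n
  · omega
  obtain ⟨i, rfl⟩ := Fin.exists_castSucc_eq.mpr (Fin.ne_last_of_lt h)
  obtain ⟨j, rfl⟩ := Fin.exists_succ_eq.mpr (Fin.ne_zero_of_lt h)
  have hij := Fin.castSucc_lt_succ_iff.mp h
  obtain ⟨hx, hy⟩ := PSSet.eq_degen_of_degen_eq_degen (S := levelAt X m k) hij e
  rw [hy]
  conv_lhs => rw [hx]
  exact congrArg (fun q => mapAt q m k _) (σ_comp_degenToLatch X hij).symm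

/-- The latching maps of simplicial symmetric spectra are injective. -/
lemma mapAt_latchToSimplices_injective (X : SimplicialObject SymSpectrum.{u}) (n m : ℕ)
    (k : SimplexCategoryᵒᵖ) : Function.Injective (mapAt (latchToSimplices X n) m k) := by
  intro z z' e
  obtain _ | n := n
  · rw [latch_zero_eq_point z, latch_zero_eq_point z']
  obtain ⟨i, x, rfl⟩ := exists_degenToLatch z
  obtain ⟨j, y, rfl⟩ := exists_degenToLatch z'
  rw [mapAt_latchToSimplices_degenToLatch, mapAt_latchToSimplices_degenToLatch] at e
  rcases lt_trichotomy i j with h | rfl | h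
  · exact mapAt_degenToLatch_eq h e
  · rw [(levelAt X m k).degen_injective i e]
  · exact (mapAt_degenToLatch_eq h e.symm).symm

/-- Reedy flat-cofibrant simplicial symmetric spectra consist of flat-cofibrant spectra. -/
lemma nuAt_injective_of_isCofibrant (hX : IsCofibrant flatCofibration X) (n m : ℕ)
    (k : SimplexCategoryᵒᵖ) : Function.Injective (nuAt (simplices X n) m k) := by
  -- With `m` and `k` fixed and `n` varying, the latching maps form one map of pointed simplicial
  -- sets. Since the Reedy latching map is a flat cofibration, the elements it identifies come from
  -- `L_m` of the Reedy latching object.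
  refine PSSet.app_injective_of_degenerate (latchAtToLevelAt X m k) ?_ ?_ n
  · intro z z' e
    rcases (hX 0).eq_or_mem_range_latchMapAt e with h | ⟨⟨w, rfl⟩, w', rfl⟩
    · exact h
    have hw : ∀ w : (latch (Reedy.latch X 0) m).obj k, w = ((latch _ m).obj k).point := by
      intro w
      induction w using smash_induction with
      | h p r e s x =>
        rw [latch_zero_eq_point x, smashMk_right]
        rfl
      | h₀ => rfl
    rw [hw w, hw w']
  · intro n z z' e
    rcases (hX (n + 1)).eq_or_mem_range_latchMapAt e with h | ⟨⟨w, rfl⟩, w', rfl⟩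
    · exact Or.inl h
    -- A class `s ∧ x` with `x` in the Reedy latching object goes to `s ∧ s_i x' = s_i (s ∧ x')`,
    -- hence is degenerate in `latchAt X m k`.
    have hw : ∀ w : (latch (Reedy.latch X (n + 1)) m).obj k, ∃ i v,
        (latchAt X m k).degen i v = latchMapAt (latchToSimplices X (n + 1)) m k w := by
      intro w
      induction w using smash_induction with
      | h p r e s x =>
        obtain ⟨i, x, rfl⟩ := exists_degenToLatch x
        refine ⟨i, smashMk (X := sphereBar) e s x, ?_⟩
        rw [latchMapAt_smashMk, mapAt_latchToSimplices_degenToLatch]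
        rfl
      | h₀ => exact ⟨0, _, Pointed.Hom.map_point _⟩
    exact Or.inr ⟨hw w, hw w'⟩

lemma mapAt_comparison_inl (f : X ⟶ Y) (n : ℕ) (x : ((simplices X n).level m).obj k) :
    mapAt (comparison f n) m k (mapAt (pushout.inl _ _) m k x) = mapAt (f.app _) m k x :=
  congrArg (fun q => mapAt q m k x) (pushout.inl_desc _ _ (latchToSimplices_naturality f n))

lemma mapAt_comparison_inr (f : X ⟶ Y) (n : ℕ) (z : ((Reedy.latch Y n).level m).obj k) :
    mapAt (comparison f n) m k (mapAt (pushout.inr _ _) m k z) =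
      mapAt (latchToSimplices Y n) m k z :=
  congrArg (fun q => mapAt q m k z) (pushout.inr_desc _ _ (latchToSimplices_naturality f n))

/-- If `f x = s_i y`, then injectivity of `f` gives `x = s_i d_i x` with `f (d_i x) = y`, so `d_i x`
in summand `i` is the required element. Thus `X_n` meets the latching object of `Y` only in that of
`X`. -/
lemma exists_of_mapAt_eq_latchToSimplices (f : X ⟶ Y) {n : ℕ}
    (hf : Function.Injective (mapAt (f.app (op (SimplexCategory.mk n))) m k))
    {x : ((simplices X n).level m).obj k} {z : ((Reedy.latch Y n).level m).obj k}
    (e : mapAt (f.app _) m k x = mapAt (latchToSimplices Y n) m k z) :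
    ∃ w, mapAt (latchToSimplices X n) m k w = x ∧ mapAt (Reedy.latchMap f n) m k w = z := by
  obtain _ | n := n
  · refine ⟨((Reedy.latch X 0).level m |>.obj k).point, ?_, ?_⟩
    · rw [mapAt_point]
      apply hf
      rw [e, latch_zero_eq_point z, mapAt_point, mapAt_point]
    · rw [mapAt_point, latch_zero_eq_point z]
  · obtain ⟨i, y, rfl⟩ := exists_degenToLatch z
    rw [mapAt_latchToSimplices_degenToLatch] at e
    obtain ⟨h₁, h₂⟩ := PSSet.eq_degen_of_app_eq_degen (levelAtMap f m k) hf e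
    refine ⟨mapAt (degenToLatch X n i) m k ((levelAt X m k).face i.castSucc x), ?_, ?_⟩
    · exact (mapAt_latchToSimplices_degenToLatch i _).trans h₁.symm
    · exact (mapAt_latchMap_degenToLatch f i _).trans (congrArg _ h₂)

/-- Both `X_n` and the Reedy latching object of `Y` inject into `Y_n`, and their overlap is already
glued in the pushout. -/
lemma mapAt_comparison_injective (f : X ⟶ Y) {n : ℕ}
    (hf : Function.Injective (mapAt (f.app (op (SimplexCategory.mk n))) m k)) :
    Function.Injective (mapAt (comparison f n) m k) := by
  have w : ∀ v, mapAt (pushout.inl (latchToSimplices X n) (Reedy.latchMap f n)) m k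
      (mapAt (latchToSimplices X n) m k v) =
      mapAt (pushout.inr _ _) m k (mapAt (Reedy.latchMap f n) m k v) :=
    fun v => congrArg (fun q => mapAt q m k v) pushout.condition
  intro z z' e
  rcases exists_of_pushout _ _ z with ⟨a, rfl⟩ | ⟨b, rfl⟩ <;>
    rcases exists_of_pushout _ _ z' with ⟨a', rfl⟩ | ⟨b', rfl⟩ <;>
    simp only [mapAt_comparison_inl, mapAt_comparison_inr] at e
  · rw [hf e]
  · obtain ⟨c, rfl, rfl⟩ := exists_of_mapAt_eq_latchToSimplices f hf e
    exact w c
  · obtain ⟨c, rfl, rfl⟩ := exists_of_mapAt_eq_latchToSimplices f hf e.symm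
    exact (w c).symm
  · rw [mapAt_latchToSimplices_injective Y n m k e]

/-- A pointwise flat cofibration between Reedy flat-cofibrant objects is injective. -/
lemma mapAt_injective_of_isPointwise {f : X ⟶ Y} (hY : IsCofibrant flatCofibration Y)
    (hf : IsPointwise flatCofibration f) (n m : ℕ) (k : SimplexCategoryᵒᵖ) :
    Function.Injective (mapAt (f.app (op (SimplexCategory.mk n))) m k) :=
  (hf n).mapAt_injective (fun m => nuAt_injective_of_isCofibrant hY n m k) m

/-- The criterion applies to the comparison map because reflection of latching images can be checked
on representatives: those from `X_n` use that `f_n` is a flat cofibration, those from the latching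
object of `Y` that `Y` is Reedy cofibrant. Naturality carries the preimages found into `L_m` of the
pushout. -/
theorem isCofibration_flatCofibration {f : X ⟶ Y} (hY : IsCofibrant flatCofibration Y)
    (hf : IsPointwise flatCofibration f) : IsCofibration flatCofibration f := by
  intro n
  refine flatCofibration_of_injective _
    (fun m k => mapAt_comparison_injective f (mapAt_injective_of_isPointwise hY hf n m k))
    (fun m k => nuAt_injective_of_isCofibrant hY n m k) ?_
  intro m k z hz
  rcases exists_of_pushout _ _ z with ⟨x, rfl⟩ | ⟨z, rfl⟩
  · rw [mapAt_comparison_inl] at hz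
    obtain ⟨v, rfl⟩ := (hf n).mem_range_nuAt hz
    exact ⟨_, (mapAt_nuAt _ m v).symm⟩
  · rw [mapAt_comparison_inr] at hz
    obtain ⟨v, rfl⟩ := (hY n).mem_range_nuAt hz
    exact ⟨_, (mapAt_nuAt _ m v).symm⟩

/-- In level `0` the comparison map is injective as before, and surjective because the surjective
`f_n(0)` factors through it. -/
theorem isCofibration_positiveFlatCofibration {f : X ⟶ Y} (hY : IsCofibrant flatCofibration Y)
    (hf : IsPointwise positiveFlatCofibration f) : IsCofibration positiveFlatCofibration f := by
  intro n
  refine ⟨isCofibration_flatCofibration hY (fun n => (hf n).1) n, ?_⟩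
  rw [PSSet.isIso_iff_bijective]
  intro k
  refine ⟨mapAt_comparison_injective f
    (mapAt_injective_of_isPointwise hY (fun n => (hf n).1) n 0 k), fun y => ?_⟩
  obtain ⟨x, hx⟩ := ((PSSet.isIso_iff_bijective _).mp (hf n).2 k).2 y
  exact ⟨_, (mapAt_comparison_inl f n x).trans hx⟩

end ReedyLatching

end SymSpectrum

/-! ### Comparison of latching maps in a single simplicial degree. -/

namespace SymSpectrum

section SimplexwiseComparison

variable {X Y : SymSpectrum.{u}} {k : SimplexCategoryᵒᵖ}

/-- A family of maps between the `k`-simplices of two symmetric spectra, for a fixed `k`, which is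
compatible with the actions and the structure maps. -/
structure SimplexwiseHom (X Y : SymSpectrum.{u}) (k : SimplexCategoryᵒᵖ) where
  /-- The component in level `n`. -/
  app (n : ℕ) : (X.level n).obj k ⟶ (Y.level n).obj k
  app_perm {n : ℕ} (τ : Equiv.Perm (Fin n)) (x : (X.level n).obj k) :
    (app n).toFun (X.perm τ x) = Y.perm τ ((app n).toFun x)
  app_sig {n : ℕ} (x : (X.level n).obj k) (t : PSSet.S1.{u}.obj k) :
    (app (n + 1)).toFun (X.sig x t) = Y.sig ((app n).toFun x) t

namespace SimplexwiseHom

variable (θ : SimplexwiseHom X Y k)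

/-- The induced map of the `k`-simplices of the latching objects. -/
def latchMap (m : ℕ) : (latch X m).obj k ⟶ (latch Y m).obj k :=
  smashLift (X := sphereBar) (Y := X) (A := (latch Y m).obj k)
    (fun e s x => smashMk e s ((θ.app _).toFun x))
    (fun e x => smashMk_left e _)
    (fun e s => by rw [Pointed.Hom.map_point]; exact smashMk_right e s)
    (fun e α β s x => by rw [θ.app_perm, smashMk_perm])
    (fun e s t x => by rw [θ.app_sig, smashMk_sig])

lemma app_iter {n : ℕ} (x : (X.level n).obj k) (m : ℕ) (s : Fin m → PSSet.S1.{u}.obj k) :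
    (θ.app (n + m)).toFun (X.iter x m s) = Y.iter ((θ.app n).toFun x) m s := by
  induction m with
  | zero => rfl
  | succ m ih =>
    simp only [iter, ← ih]
    exact θ.app_sig _ _

lemma app_mapE {a b : ℕ} (e : Fin a ≃ Fin b) (x : (X.level a).obj k) :
    (θ.app b).toFun (X.mapE e x) = Y.mapE e ((θ.app a).toFun x) := by
  obtain rfl : a = b := Fin.equiv_iff_eq.mp ⟨e⟩
  exact θ.app_perm e x

/-- In a fixed simplicial degree the latching map is built from permutations and iterated structure
maps alone, so compatibility with simplicial operators plays no role. -/
lemma app_nuAt (m : ℕ) (z : (latch X m).obj k) :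
    (θ.app m).toFun (nuAt X m k z) = nuAt Y m k ((θ.latchMap m).toFun z) := by
  induction z using smash_induction with
  | h p r e s x =>
    induction s using sphere_induction with
    | h h s =>
      have h1 : (θ.app m).toFun (X.mapE (flipEquiv e) (X.iter x p s)) =
          Y.mapE (flipEquiv e) (Y.iter ((θ.app r).toFun x) p s) := by
        rw [app_mapE, app_iter]
      exact h1
    | h₀ => exact (θ.app m).map_point
  | h₀ => exact (θ.app m).map_point

lemma mem_range_nuAt {m : ℕ} {x : (X.level m).obj k} (hx : x ∈ Set.range (nuAt X m k)) :
    (θ.app m).toFun x ∈ Set.range (nuAt Y m k) := by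
  obtain ⟨z, rfl⟩ := hx
  exact ⟨_, (θ.app_nuAt m z).symm⟩

/-- The map of latching objects induced by `θ` is split by the one induced by `η`, so an equality of
latching images in `X` can be tested in `Y`. -/
lemma nuAt_injective (η : SimplexwiseHom Y X k)
    (h : ∀ n x, (η.app n).toFun ((θ.app n).toFun x) = x) {m : ℕ}
    (hY : Function.Injective (nuAt Y m k)) : Function.Injective (nuAt X m k) := by
  have h' : Function.LeftInverse (η.latchMap m).toFun (θ.latchMap m).toFun := by
    intro z
    induction z using smash_induction with
    | h p r e s x => exact congrArg (smashMk (X := sphereBar) e s) (h r x)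
    | h₀ => rfl
  intro z z' e
  apply h'.injective
  apply hY
  rw [← θ.app_nuAt, ← θ.app_nuAt, e]

end SimplexwiseHom

end SimplexwiseComparison

/-! ### The diagonal of a simplicial symmetric spectrum. -/

section Diagonal

variable (X : SimplicialObject SymSpectrum.{u})

/-- The pointed simplicial set `k ↦ X_k(m)_k`. -/
def diagonalLevel (m : ℕ) : PSSet.{u} where
  obj k := ((X.obj k).level m).obj k
  map {k l} φ := ((X.map φ).app m).app k ≫ ((X.obj l).level m).map φ
  map_id k := by simp
  map_comp {k l j} φ ψ := by
    -- The operator `φ` internal to the levels commutes with the map induced by the external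
    -- operator `ψ`.
    have h := ((X.map ψ).app m).naturality φ
    simp only [X.map_comp, comp_app, NatTrans.comp_app, Functor.map_comp, Category.assoc]
    rw [reassoc_of% h]

/-- The diagonal of a simplicial symmetric spectrum `X`: the symmetric spectrum whose
`k`-simplices in level `m` are `X_k(m)_k`. -/
def diagonal : SymSpectrum.{u} :=
  ofElements (diagonalLevel X)
    (fun m =>
      { toFun := fun τ =>
          { app := fun k => NatTrans.app ((X.obj k).act m τ) k
            naturality := fun k l φ => by
              apply Pointed.Hom.ext
              funext x
              exact ((X.obj l).perm_map τ φ _).trans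
                (congrArg _ (Hom.app_perm (X.map φ) τ x).symm) }
        map_one' := by
          apply NatTrans.ext
          funext k
          apply Pointed.Hom.ext
          funext x
          exact (X.obj k).perm_one x
        map_mul' := fun τ π => by
          apply NatTrans.ext
          funext k
          apply Pointed.Hom.ext
          funext x
          exact (X.obj k).perm_mul τ π x })
    (fun {_ k} x t => (X.obj k).sig x t)
    (fun {_ k} t => (X.obj k).sig_point_left t)
    (fun {_ k} x => (X.obj k).sig_point_right x)
    (fun {_ k l} φ x t => ((X.obj l).sig_map φ _ t).trans
      (congrArg _ (Hom.app_sig (X.map φ) x t).symm))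
    (fun {_ k} τ x t => (X.obj k).sig_perm τ x t)
    (fun {_ k} x s t => (X.obj k).sig_sig x s t)

variable {X}

/-- The map of diagonals induced by a morphism of simplicial symmetric spectra. -/
def diagonalMap {Y : SimplicialObject SymSpectrum.{u}} (f : X ⟶ Y) : diagonal X ⟶ diagonal Y :=
  homMk
    (fun n =>
      { app := fun k => ((f.app k).app n).app k
        naturality := fun k l φ => by
          apply Pointed.Hom.ext
          funext x
          have h : mapAt (f.app l) n k (mapAt (X.map φ) n k x) =
              mapAt (Y.map φ) n k (mapAt (f.app k) n k x) :=
            congrArg (fun q : X.obj k ⟶ Y.obj l => mapAt q n k x) (f.naturality φ)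
          exact (PSSet.naturality_apply ((f.app l).app n) φ _).trans (congrArg _ h) })
    (fun {_ k} τ x => Hom.app_perm (f.app k) τ x)
    (fun {_ k} x t => Hom.app_sig (f.app k) x t)

end Diagonal

/-! ### The geometric realization is the diagonal. -/

section Realization

variable {X Y : SimplicialObject SymSpectrum.{u}} {m : ℕ} {k l : SimplexCategoryᵒᵖ}
  {i j : SimplexCategory}

/-- The element `x ∧ g` of `A(m) ∧ Δ[j]₊`. -/
def tensorSimplexMk {A : SymSpectrum.{u}} (x : (A.level m).obj k) (g : k.unop ⟶ j) :
    ((tensor A (PSSet.plus.obj (SSet.stdSimplex.{u}.obj j))).level m).obj k :=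
  Pointed.smash.mk (B := (PSSet.plus.obj (SSet.stdSimplex.{u}.obj j)).obj k) x
    (some (SSet.stdSimplex.objEquiv.symm g))

/-- The class of `x ∧ g` in the geometric realization. -/
noncomputable def realizationMk (x : ((X.obj (op j)).level m).obj k) (g : k.unop ⟶ j) :
    ((realization X).level m).obj k :=
  mapAt (coend.ι (realizationDiagram.obj X) j) m k (tensorSimplexMk x g)

lemma realizationMk_point (g : k.unop ⟶ j) :
    realizationMk (X := X) (((X.obj (op j)).level m).obj k).point g =
      (((realization X).level m).obj k).point :=
  (congrArg _ (Pointed.smash.mk_point_left _)).trans (mapAt_point _ m)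

/-- This is the coend relation: simplicial operators move from the spectrum factor to the simplex
factor. -/
lemma realizationMk_map (a : i ⟶ j) (x : ((X.obj (op j)).level m).obj k) (g : k.unop ⟶ i) :
    realizationMk (mapAt (X.map a.op) m k x) g = realizationMk x (g ≫ a) :=
  congrArg (fun q : tensor (X.obj (op j)) (PSSet.plus.obj (SSet.stdSimplex.{u}.obj i)) ⟶
      realization X => mapAt q m k (tensorSimplexMk x g))
    (coend.condition (realizationDiagram.obj X) a)

lemma map_realizationMk (φ : k ⟶ l) (x : ((X.obj (op j)).level m).obj k) (g : k.unop ⟶ j) :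
    (((realization X).level m).map φ).toFun (realizationMk x g) =
      realizationMk ((((X.obj (op j)).level m).map φ).toFun x) (φ.unop ≫ g) :=
  (PSSet.naturality_apply ((coend.ι (realizationDiagram.obj X) j).app m) φ _).symm

lemma perm_realizationMk (τ : Equiv.Perm (Fin m)) (x : ((X.obj (op j)).level m).obj k)
    (g : k.unop ⟶ j) :
    (realization X).perm τ (realizationMk x g) = realizationMk ((X.obj (op j)).perm τ x) g :=
  (Hom.app_perm (coend.ι (realizationDiagram.obj X) j) τ (tensorSimplexMk x g)).symm

lemma sig_realizationMk (x : ((X.obj (op j)).level m).obj k) (g : k.unop ⟶ j)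
    (t : PSSet.S1.{u}.obj k) :
    (realization X).sig (realizationMk x g) t = realizationMk ((X.obj (op j)).sig x t) g :=
  (Hom.app_sig (coend.ι (realizationDiagram.obj X) j) (tensorSimplexMk x g) t).symm

lemma mapAt_realizationMap (f : X ⟶ Y) (x : ((X.obj (op j)).level m).obj k) (g : k.unop ⟶ j) :
    mapAt (realizationMap f) m k (realizationMk x g) =
      realizationMk (mapAt (f.app (op j)) m k x) g :=
  congrArg (fun q => mapAt q m k (tensorSimplexMk x g)) (coend.ι_map (realizationDiagram.map f) j)

lemma tensor_simplex_hom_ext {A Z : SymSpectrum.{u}}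
    {q q' : tensor A (PSSet.plus.obj (SSet.stdSimplex.{u}.obj j)) ⟶ Z}
    (h : ∀ m k (x : (A.level m).obj k) (g : k.unop ⟶ j),
      mapAt q m k (tensorSimplexMk x g) = mapAt q' m k (tensorSimplexMk x g)) : q = q' := by
  apply hom_ext
  intro m
  apply NatTrans.ext
  funext k
  refine Pointed.smash.hom_ext fun x o => ?_
  rcases o with _ | g
  · have e := Pointed.smash.mk_point_right (B := (PSSet.plus.obj (SSet.stdSimplex.{u}.obj j)).obj k)
      x
    exact (congrArg (mapAt q m k) e).trans ((mapAt_point q m).trans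
      ((congrArg (mapAt q' m k) e).trans (mapAt_point q' m)).symm)
  · have := h m k x (SSet.stdSimplex.objEquiv g)
    rwa [tensorSimplexMk, Equiv.symm_apply_apply] at this

lemma realization_hom_ext {Z : SymSpectrum.{u}} {q q' : realization X ⟶ Z}
    (h : ∀ m k (j : SimplexCategory) (x : ((X.obj (op j)).level m).obj k) (g : k.unop ⟶ j),
      mapAt q m k (realizationMk x g) = mapAt q' m k (realizationMk x g)) : q = q' :=
  coend.hom_ext fun j => tensor_simplex_hom_ext fun m k x g => h m k j x g

/-- The map `X_j ∧ Δ[j]₊ ⟶ diag X` sending `x ∧ g` to `g^* x`. -/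
def tensorToDiagonal (X : SimplicialObject SymSpectrum.{u}) (j : SimplexCategory) :
    tensor (X.obj (op j)) (PSSet.plus.obj (SSet.stdSimplex.{u}.obj j)) ⟶ diagonal X :=
  homMk
    (fun m =>
      { app := fun k => Pointed.smash.lift
          (A := ((X.obj (op j)).level m).obj k)
          (B := (PSSet.plus.obj (SSet.stdSimplex.{u}.obj j)).obj k)
          (C := ((diagonal X).level m).obj k)
          (fun x o => Option.elim o (((X.obj k).level m).obj k).point
            (fun g => mapAt (X.map (SSet.stdSimplex.objEquiv g).op) m k x))
          (fun o => by
            rcases o with _ | g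
            · rfl
            · exact mapAt_point _ m)
          (fun x => rfl)
        naturality := fun k l φ => by
          refine Pointed.smash.hom_ext fun x o => ?_
          -- The operator `φ` acts on the simplex coordinate by precomposition and on the levels
          -- internally; the diagonal combines the two actions, which commute by naturality.
          rcases o with _ | g
          · exact (Pointed.Hom.map_point (((diagonal X).level m).map φ)).symm
          · have h₁ : mapAt (X.map (φ.unop ≫ SSet.stdSimplex.objEquiv g).op) m l
                ((((X.obj (op j)).level m).map φ).toFun x) =
                mapAt (X.map φ) m l (mapAt (X.map (SSet.stdSimplex.objEquiv g).op) m l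
                  ((((X.obj (op j)).level m).map φ).toFun x)) := by
              rw [op_comp, X.map_comp]
              rfl
            refine h₁.trans ?_
            have h₂ := PSSet.naturality_apply
              (Hom.app (X.map (SSet.stdSimplex.objEquiv g).op ≫ X.map φ) m) φ x
            exact h₂ })
    (fun {m k} τ z => by
      induction z using Quot.inductionOn with
      | h z =>
        rcases z with ⟨x, _ | g⟩
        · exact ((diagonal X).perm_point τ).symm
        · exact Hom.app_perm (X.map (SSet.stdSimplex.objEquiv g).op) τ x)
    (fun {m k} z t => by
      induction z using Quot.inductionOn with
      | h z =>
        rcases z with ⟨x, _ | g⟩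
        · exact ((diagonal X).sig_point_left t).symm
        · exact Hom.app_sig (X.map (SSet.stdSimplex.objEquiv g).op) x t)

/-- The map `|X| ⟶ diag X` sending the class of `x ∧ g` to `g^* x`. -/
noncomputable def realizationToDiagonal (X : SimplicialObject SymSpectrum.{u}) :
    realization X ⟶ diagonal X :=
  coend.desc (F := realizationDiagram.obj X) (fun j => tensorToDiagonal X j) (by
    intro i j a
    refine tensor_simplex_hom_ext fun m k x g => ?_
    have h : mapAt (X.map g.op) m k (mapAt (X.map a.op) m k x) =
        mapAt (X.map (g ≫ a).op) m k x := by
      rw [op_comp, X.map_comp]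
      rfl
    exact h)

lemma mapAt_realizationToDiagonal (x : ((X.obj (op j)).level m).obj k) (g : k.unop ⟶ j) :
    mapAt (realizationToDiagonal X) m k (realizationMk x g) = mapAt (X.map g.op) m k x :=
  congrArg (fun q => mapAt q m k (tensorSimplexMk x g))
    (coend.ι_desc (F := realizationDiagram.obj X) (fun j => tensorToDiagonal X j) _ j)

/-- The map `diag X ⟶ |X|` sending `x ∈ X_k(m)_k` to the class of `x ∧ id`. -/
noncomputable def diagonalToRealization (X : SimplicialObject SymSpectrum.{u}) :
    diagonal X ⟶ realization X :=
  homMk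
    (fun m =>
      { app := fun k => ⟨fun x => realizationMk (j := k.unop) x (𝟙 k.unop),
          realizationMk_point _⟩
        naturality := fun k l φ => by
          apply Pointed.Hom.ext
          funext x
          refine Eq.trans ?_ (map_realizationMk φ (j := k.unop) x (𝟙 k.unop)).symm
          -- Internally `φ` sends `x ∧ id` to `φ^* x ∧ φ`; the coend relation trades the factor `φ`
          -- for the external operator `X.map φ`, which gives the diagonal action.
          rw [Category.comp_id, ← Category.id_comp φ.unop, ← realizationMk_map]
          exact congrArg (fun y => realizationMk (j := l.unop) y (𝟙 l.unop))
            (PSSet.naturality_apply ((X.map φ).app m) φ x).symm })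
    (fun {m k} τ x => (perm_realizationMk τ (j := k.unop) x (𝟙 k.unop)).symm)
    (fun {m k} x t => (sig_realizationMk (j := k.unop) x (𝟙 k.unop) t).symm)

/-- The geometric realization of a simplicial symmetric spectrum is its diagonal. -/
noncomputable def realizationIso (X : SimplicialObject SymSpectrum.{u}) :
    realization X ≅ diagonal X where
  hom := realizationToDiagonal X
  inv := diagonalToRealization X
  hom_inv_id := by
    apply realization_hom_ext
    intro m k j x g
    rw [mapAt_comp, mapAt_realizationToDiagonal]
    -- The class of `x ∧ g` goes to `g^* x` and back to `g^* x ∧ id`, which the coend relation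
    -- identifies with `x ∧ g`.
    exact (realizationMk_map (i := k.unop) g x (𝟙 k.unop)).trans
      (congrArg (realizationMk x) (Category.id_comp g))
  inv_hom_id := by
    apply hom_ext
    intro m
    apply NatTrans.ext
    funext k
    apply Pointed.Hom.ext
    funext x
    refine (mapAt_realizationToDiagonal (j := k.unop) x (𝟙 k.unop)).trans ?_
    exact congrArg (fun q : X.obj k ⟶ X.obj k => mapAt q m k x) (X.map_id k)

lemma realizationIso_hom_naturality (f : X ⟶ Y) :
    realizationMap f ≫ (realizationIso Y).hom = (realizationIso X).hom ≫ diagonalMap f := by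
  apply realization_hom_ext
  intro m k j x g
  have h : mapAt (Y.map g.op) m k (mapAt (f.app (op j)) m k x) =
      mapAt (f.app k) m k (mapAt (X.map g.op) m k x) :=
    (congrArg (fun q => mapAt q m k x) (f.naturality g.op)).symm
  exact ((congrArg _ (mapAt_realizationMap f x g)).trans (mapAt_realizationToDiagonal _ g)).trans
    (h.trans (congrArg (mapAt (diagonalMap f) m k) (mapAt_realizationToDiagonal x g).symm))

/-- The identification of the `k`-simplices of `|X|` with those of `X_k`. -/
noncomputable def realizationTo (X : SimplicialObject SymSpectrum.{u}) (k : SimplexCategoryᵒᵖ) :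
    SimplexwiseHom (realization X) (X.obj k) k where
  app n := ((realizationIso X).hom.app n).app k
  app_perm τ x := Hom.app_perm (realizationIso X).hom τ x
  app_sig x t := Hom.app_sig (realizationIso X).hom x t

/-- The identification of the `k`-simplices of `|X|` with those of `X_k`. -/
noncomputable def toRealization (X : SimplicialObject SymSpectrum.{u}) (k : SimplexCategoryᵒᵖ) :
    SimplexwiseHom (X.obj k) (realization X) k where
  app n := ((realizationIso X).inv.app n).app k
  app_perm τ x := Hom.app_perm (realizationIso X).inv τ x
  app_sig x t := Hom.app_sig (realizationIso X).inv x t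

lemma toRealization_realizationTo (x : ((realization X).level m).obj k) :
    ((toRealization X k).app m).toFun (((realizationTo X k).app m).toFun x) = x :=
  congrArg (fun q => mapAt q m k x) (realizationIso X).hom_inv_id

lemma realizationTo_toRealization (x : ((X.obj k).level m).obj k) :
    ((realizationTo X k).app m).toFun (((toRealization X k).app m).toFun x) = x :=
  congrArg (fun q : diagonal X ⟶ diagonal X => mapAt q m k x) (realizationIso X).inv_hom_id

lemma realizationTo_mapAt (f : X ⟶ Y) (x : ((realization X).level m).obj k) :
    ((realizationTo Y k).app m).toFun (mapAt (realizationMap f) m k x) =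
      mapAt (f.app k) m k (((realizationTo X k).app m).toFun x) :=
  congrArg (fun q => mapAt q m k x) (realizationIso_hom_naturality f)

lemma toRealization_mapAt (f : X ⟶ Y) (x : ((X.obj k).level m).obj k) :
    ((toRealization Y k).app m).toFun (mapAt (f.app k) m k x) =
      mapAt (realizationMap f) m k (((toRealization X k).app m).toFun x) := by
  rw [← toRealization_realizationTo (mapAt (realizationMap f) m k _), realizationTo_mapAt,
    realizationTo_toRealization]

/-! ### Realizations of pointwise flat cofibrations. -/

open Reedy

/-- Each condition of the criterion concerns one simplicial degree `k`, where `|f|` is identified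
with `f_k` together with the latching maps; for `f_k` all three conditions are known. -/
theorem flatCofibration_realizationMap {f : X ⟶ Y} (hY : IsCofibrant flatCofibration Y)
    (hf : IsPointwise flatCofibration f) : flatCofibration (realizationMap f) := by
  refine flatCofibration_of_injective _ (fun m k x x' e => ?_) (fun m k => ?_) (fun m k x hx => ?_)
  · have e' := congrArg ((realizationTo Y k).app m).toFun e
    rw [realizationTo_mapAt, realizationTo_mapAt] at e'
    rw [← toRealization_realizationTo x, ← toRealization_realizationTo x',
      mapAt_injective_of_isPointwise hY hf k.unop.len m k e']
  · exact (realizationTo Y k).nuAt_injective (toRealization Y k)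
      (fun n x => toRealization_realizationTo x)
      (nuAt_injective_of_isCofibrant hY k.unop.len m k)
  · have hx' := (realizationTo Y k).mem_range_nuAt hx
    rw [realizationTo_mapAt] at hx'
    rw [← toRealization_realizationTo x]
    exact (toRealization X k).mem_range_nuAt ((hf k.unop.len).mem_range_nuAt hx')

/-- In level `0` and degree `k` the map `|f|` is conjugate to `f_k(0)_k`, which is bijective. -/
theorem positiveFlatCofibration_realizationMap {f : X ⟶ Y} (hY : IsCofibrant flatCofibration Y)
    (hf : IsPointwise positiveFlatCofibration f) :
    positiveFlatCofibration (realizationMap f) := by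
  have hf' : IsPointwise flatCofibration f := fun n => (hf n).1
  refine ⟨flatCofibration_realizationMap hY hf', ?_⟩
  rw [PSSet.isIso_iff_bijective]
  intro k
  have hk := (PSSet.isIso_iff_bijective _).mp (hf k.unop.len).2 k
  constructor
  · intro x x' e
    have e' := congrArg ((realizationTo Y k).app 0).toFun e
    have h := fun x => realizationTo_mapAt f (m := 0) (k := k) x
    rw [← toRealization_realizationTo x, ← toRealization_realizationTo x',
      hk.1 ((h x).symm.trans (e'.trans (h x')))]
  · intro y
    obtain ⟨x, hx⟩ := hk.2 (((realizationTo Y k).app 0).toFun y)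
    refine ⟨((toRealization X k).app 0).toFun x, ?_⟩
    refine (toRealization_mapAt f x).symm.trans ?_
    exact (congrArg _ hx).trans (toRealization_realizationTo y)

end Realization

end SymSpectrum

theorem theorem4p2 {X Y : SimplicialObject SymSpectrum.{u}} (f : X ⟶ Y)
    (hX : Reedy.IsCofibrant SymSpectrum.flatCofibration X)
    (hY : Reedy.IsCofibrant SymSpectrum.flatCofibration Y) :
    (Reedy.IsPointwise SymSpectrum.flatCofibration f →
      Reedy.IsCofibration SymSpectrum.flatCofibration f ∧
        SymSpectrum.flatCofibration (SymSpectrum.realizationMap f)) ∧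
    (Reedy.IsPointwise SymSpectrum.positiveFlatCofibration f →
      Reedy.IsCofibration SymSpectrum.positiveFlatCofibration f ∧
        SymSpectrum.positiveFlatCofibration (SymSpectrum.realizationMap f)) :=
  ⟨fun hf => ⟨SymSpectrum.isCofibration_flatCofibration hY hf,
      SymSpectrum.flatCofibration_realizationMap hY hf⟩,
    fun hf => ⟨SymSpectrum.isCofibration_positiveFlatCofibration hY hf,
      SymSpectrum.positiveFlatCofibration_realizationMap hY hf⟩⟩
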